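/- All varieties are over $\mathbb C$. A contraction is a projective morphism $f:X\to Y$ of varieties with $f_*\mathcal O_X=\mathcal O_Y$ (via the natural map). An ample (resp. ample$/Z$) $\mathbb R$-divisor is a non-empty finite sum $\sum_i a_iH_i$ with real numbers $a_i>0$ and Cartier divisors $H_i$ that are ample (resp. ample over $Z$). Let $X',X,Z$ be normal quasi-projective varieties and let $h:X'\to X$ and $f:X'\to Z$ be contractions. Then there exists a normal quasi-projective variety $\bar X$ with two contractions $\bar h:\bar X\to X$ and $\bar f:\bar X\to Z$ such that 1. for every ample $\mathbb R$-divisor $A$ on $X$, the pullback $\bar h^*A$ is ample$/Z$ (with respect to $\bar f$); 2. there exists a contraction $g:X'\to\bar X$ such that $\bar h\circ g=h$ and $\bar f\circ g=f$. It is unique up to isomorphism: if $(\bar X_1,\bar h_1,\bar f_1)$ and $(\bar X_2,\bar h_2,\bar f_2)$ both satisfy (1) and (2), then there is an isomorphism $e:\bar X_1\to\bar X_2$ over $\mathbb C$ with $\bar h_2\circ e=\bar h_1$ and $\bar f_2\circ e=\bar f_1$. The variety $\bar X$ is called the core model of $(h,f)$ associated with $(\bar h,\bar f)$. Moreover, let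 $\bar X$ be the core model of $(h,f)$ associated with $(\bar h,\bar f)$, let $X''$ be a normal quasi-projective variety, let $\phi:X'\dashrightarrow X''$ be a dominant rational map such that $K(X'')$ is algebraically closed in $K(X')$ (via $\phi^*$), and let $h'':X''\to X$ and $f'':X''\to Z$ be contractions such that $h''\circ\phi=h$ and $f''\circ\phi=f$ as rational maps. Then $\bar X$ is the core model of $(h'',f'')$ associated with $(\bar h,\bar f)$. Here every birational map and every contraction $\phi$ from $X'$ to a normal quasi-projective variety $X''$ is dominant with $K(X'')$ algebraically closed in $K(X')$. -/

import Mathlib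

open CategoryTheory AlgebraicGeometry
open scoped TensorProduct

noncomputable section

namespace CoreModel

universe u

/-! ## Function fields -/

/-- A dominant morphism of integral schemes maps the generic point to the generic point. -/
lemma map_genericPoint {X Y : Scheme.{u}} [IsIntegral X] [IsIntegral Y] (f : X ⟶ Y)
    [IsDominant f] : f (genericPoint X) = genericPoint Y := by
  have h := (genericPoint_spec X).image f.continuous
  have h' : closure (f '' Set.univ) = Set.univ := by
    rw [Set.image_univ]; exact f.denseRange.closure_range
  rw [h'] at h
  exact h.eq (genericPoint_spec Y)

/-- The field extension `K(Y) → K(X)` induced by a dominant morphism of integral schemes. -/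
def functionFieldMap {X Y : Scheme.{u}} [IsIntegral X] [IsIntegral Y] (f : X ⟶ Y)
    [IsDominant f] : Y.functionField →+* X.functionField :=
  (Y.presheaf.stalkSpecializes (specializes_of_eq (map_genericPoint f)) ≫
    f.stalkMap (genericPoint X)).hom

/-- The inclusions of the local rings in the function fields are compatible with pullback. -/
lemma functionFieldMap_algebraMap {X Y : Scheme.{u}} [IsIntegral X] [IsIntegral Y] (f : X ⟶ Y)
    [IsDominant f] (x : X) (a : Y.presheaf.stalk (f x)) :
    functionFieldMap f (algebraMap (Y.presheaf.stalk (f x)) Y.functionField a) =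
      algebraMap (X.presheaf.stalk x) X.functionField ((f.stalkMap x).hom a) := by
  have hs : genericPoint X ⤳ x := (genericPoint_spec X).specializes trivial
  have key := Scheme.Hom.stalkSpecializes_stalkMap_apply f _ _ hs a
  refine Eq.trans ?_ key
  change f.stalkMap (genericPoint X) (Y.presheaf.stalkSpecializes _
    (Y.presheaf.stalkSpecializes _ a)) = _
  congr 1
  rw [← CategoryTheory.comp_apply, TopCat.Presheaf.stalkSpecializes_comp]

/-- The morphism `Spec K(X) ⟶ Y` given by a dominant rational map `φ : X ⤏ Y` hits the generic
point of `Y`. -/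
lemma fromFunctionField_closedPoint {X Y : Scheme.{u}} [IsIntegral X] [IsIntegral Y]
    (φ : X ⤏ Y) [hφ : φ.IsDominant] :
    φ.fromFunctionField (IsLocalRing.closedPoint X.functionField) = genericPoint Y := by
  obtain ⟨g, rfl⟩ := φ.exists_rep
  have hg : IsDominant g.hom := g.isDominant_toRationalMap_iff.mp hφ
  have : Nonempty g.domain := g.dense_domain.nonempty.to_subtype
  have hx : genericPoint X ∈ g.domain :=
    ((genericPoint_spec X).mem_open_set_iff g.domain.isOpen).mpr
      (by simpa using g.dense_domain.nonempty)
  have h1 : g.domain.fromSpecStalkOfMem (genericPoint X) hx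
      (IsLocalRing.closedPoint X.functionField) = genericPoint g.domain := by
    apply g.domain.ι.isOpenEmbedding.injective
    rw [genericPoint_eq_of_isOpenImmersion g.domain.ι]
    refine (Scheme.Hom.comp_apply (g.domain.fromSpecStalkOfMem (genericPoint X) hx)
      g.domain.ι _).symm.trans ?_
    rw [Scheme.Opens.fromSpecStalkOfMem_ι]
    exact Scheme.fromSpecStalk_closedPoint
  change (g.domain.fromSpecStalkOfMem (genericPoint X) hx ≫ g.hom)
    (IsLocalRing.closedPoint X.functionField) = genericPoint Y
  refine (Scheme.Hom.comp_apply _ g.hom _).trans ?_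
  exact (congrArg g.hom h1).trans (map_genericPoint g.hom)

/-- The field extension `φ^* : K(Y) → K(X)` given by a dominant rational map `φ : X ⤏ Y` of
integral schemes. -/
def rationalFunctionFieldMap {X Y : Scheme.{u}} [IsIntegral X] [IsIntegral Y]
    (φ : X ⤏ Y) [φ.IsDominant] : Y.functionField →+* X.functionField :=
  (Y.presheaf.stalkSpecializes (specializes_of_eq (fromFunctionField_closedPoint φ)) ≫
    Scheme.stalkClosedPointTo φ.fromFunctionField).hom

/-- `K(Y)` is algebraically closed in `K(X)`, along the extension `φ^* : K(Y) → K(X)`: every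
element of `K(X)` which is algebraic over `K(Y)` lies in `K(Y)`. -/
def FunctionFieldAlgClosed {X Y : Scheme.{u}} [IsIntegral X] [IsIntegral Y]
    (φ : X ⤏ Y) [φ.IsDominant] : Prop :=
  ∀ x : X.functionField,
    (∃ p : Polynomial Y.functionField, p ≠ 0 ∧ p.eval₂ (rationalFunctionFieldMap φ) x = 0) →
      x ∈ (rationalFunctionFieldMap φ).range

/-! ## Cartier divisors and `ℝ`-Cartier `ℝ`-divisors -/

section Cartier

variable (X : Scheme.{u}) [IsIntegral X]

/-- The units of the local ring at `x`, as a subgroup of `K(X)ˣ`. -/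
def localUnits (x : X) : Subgroup X.functionFieldˣ :=
  (Units.map (algebraMap (X.presheaf.stalk x) X.functionField).toMonoidHom).range

/-- The group of Cartier divisors on an integral scheme, that is, the global sections of the sheaf
`K(X)ˣ / 𝒪_Xˣ`, where `K(X)ˣ` is the constant sheaf: such a section is a family of germs in
`K(X)ˣ / 𝒪_{X,x}ˣ` which is locally given by a single rational function. -/
def CartierDivisor : AddSubgroup (∀ x : X, Additive (X.functionFieldˣ ⧸ localUnits X x)) where
  carrier := {D | ∀ x : X, ∃ U : X.Opens, x ∈ U ∧ ∃ d : X.functionFieldˣ,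
    ∀ y ∈ U, D y = Additive.ofMul (QuotientGroup.mk d)}
  zero_mem' := fun x => ⟨⊤, trivial, 1, fun _ _ => rfl⟩
  add_mem' := by
    intro D E hD hE x
    obtain ⟨U, hU, d, hd⟩ := hD x
    obtain ⟨V, hV, e, he⟩ := hE x
    refine ⟨U ⊓ V, ⟨hU, hV⟩, d * e, fun y hy => ?_⟩
    rw [Pi.add_apply, hd y hy.1, he y hy.2]
    rfl
  neg_mem' := by
    intro D hD x
    obtain ⟨U, hU, d, hd⟩ := hD x
    refine ⟨U, hU, d⁻¹, fun y hy => ?_⟩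
    rw [Pi.neg_apply, hd y hy]
    rfl

/-- `ℝ`-Cartier `ℝ`-divisors: finite `ℝ`-linear combinations of Cartier divisors. -/
abbrev RCartierDivisor : Type u := ℝ ⊗[ℤ] CartierDivisor X

end Cartier

/-- `d` is a local equation of the Cartier divisor `D` at the point `x`. -/
def IsLocalEquation {X : Scheme.{u}} [IsIntegral X] (D : CartierDivisor X) (x : X)
    (d : X.functionFieldˣ) : Prop :=
  D.1 x = Additive.ofMul (QuotientGroup.mk d)

/-- The pullback of germs of Cartier divisors, `K(Y)ˣ / 𝒪_{Y,f(x)}ˣ → K(X)ˣ / 𝒪_{X,x}ˣ`. -/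
def pullbackGerm {X Y : Scheme.{u}} [IsIntegral X] [IsIntegral Y] (f : X ⟶ Y) [IsDominant f]
    (x : X) : (Y.functionFieldˣ ⧸ localUnits Y (f x)) →* (X.functionFieldˣ ⧸ localUnits X x) :=
  QuotientGroup.map _ _ (Units.map (functionFieldMap f).toMonoidHom) (by
    rintro _ ⟨a, rfl⟩
    refine ⟨Units.map (f.stalkMap x).hom.toMonoidHom a, ?_⟩
    ext
    exact (functionFieldMap_algebraMap f x a).symm)

/-- The pullback of Cartier divisors along a dominant morphism, by pulling back local equations. -/
def pullbackCartier {X Y : Scheme.{u}} [IsIntegral X] [IsIntegral Y] (f : X ⟶ Y) [IsDominant f] :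
    CartierDivisor Y →+ CartierDivisor X where
  toFun D := ⟨fun x => (pullbackGerm f x).toAdditive (D.1 (f x)), fun x => by
    obtain ⟨U, hU, d, hd⟩ := D.2 (f x)
    refine ⟨f ⁻¹ᵁ U, hU, Units.map (functionFieldMap f).toMonoidHom d, fun y hy => ?_⟩
    change (pullbackGerm f y).toAdditive (D.1 (f y)) = _
    rw [hd (f y) hy]
    rfl⟩
  map_zero' := by
    ext x
    exact map_zero (pullbackGerm f x).toAdditive
  map_add' D E := by
    ext x
    exact map_add (pullbackGerm f x).toAdditive _ _

/-- The `ℝ`-linear pullback of `ℝ`-Cartier `ℝ`-divisors along a dominant morphism. -/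
def pullbackRCartier {X Y : Scheme.{u}} [IsIntegral X] [IsIntegral Y] (f : X ⟶ Y) [IsDominant f] :
    RCartierDivisor Y →ₗ[ℝ] RCartierDivisor X :=
  (pullbackCartier f).toIntLinearMap.baseChange ℝ

/-! ## Ampleness -/

/-- The rational function `s` is a section of `𝒪_X(D)` over the open subset `U`, that is,
`div s + D ≥ 0` on `U`. -/
def IsSection {X : Scheme.{u}} [IsIntegral X] (D : CartierDivisor X) (U : X.Opens)
    (s : X.functionField) : Prop :=
  ∀ y ∈ U, ∃ d, IsLocalEquation D y d ∧
    ∃ a : X.presheaf.stalk y, algebraMap (X.presheaf.stalk y) X.functionField a = s * d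

/-- The section `s` of `𝒪_X(D)` generates `𝒪_X(D)` at the point `y`. -/
def GeneratesAt {X : Scheme.{u}} [IsIntegral X] (D : CartierDivisor X)
    (s : X.functionField) (y : X) : Prop :=
  ∃ d, IsLocalEquation D y d ∧ ∃ a : X.presheaf.stalk y, IsUnit a ∧
    algebraMap (X.presheaf.stalk y) X.functionField a = s * d

/-- The invertible sheaf `𝒪_X(D)` restricted to the open subscheme `U` is ample: `U` is
quasi-compact, and every point of `U` lies in an affine non-vanishing locus `U_s`
of a section `s` over `U` of some `𝒪_X(nD)`, `n ≥ 1`. -/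
def IsAmpleOn {X : Scheme.{u}} [IsIntegral X] (D : CartierDivisor X) (U : X.Opens) : Prop :=
  IsCompact (U : Set X) ∧ ∀ x ∈ U, ∃ n : ℕ, 1 ≤ n ∧ ∃ s : X.functionField,
    IsSection (n • D) U s ∧ ∃ W : X.Opens, IsAffineOpen W ∧ x ∈ W ∧
      ∀ y : X, y ∈ W ↔ y ∈ U ∧ GeneratesAt (n • D) s y

/-- The Cartier divisor `D` on `X` is ample over `S`, with respect to `f : X ⟶ S`: its restriction
to the preimage of every affine open subset of `S` is ample. If `S` is the spectrum of a field, this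
says that `D` is ample. -/
def IsAmpleOver {X S : Scheme.{u}} [IsIntegral X] (f : X ⟶ S) (D : CartierDivisor X) : Prop :=
  ∀ V : S.Opens, IsAffineOpen V → IsAmpleOn D (f ⁻¹ᵁ V)

/-- An `ℝ`-divisor on `X` is ample over `S` if it is a (non-empty) finite sum
`∑ aᵢ Hᵢ` with real coefficients `aᵢ > 0` and Cartier divisors `Hᵢ` which are ample over `S`. -/
def IsRAmpleOver {X S : Scheme.{u}} [IsIntegral X] (f : X ⟶ S) (A : RCartierDivisor X) : Prop :=
  ∃ (m : ℕ) (a : Fin (m + 1) → ℝ) (H : Fin (m + 1) → CartierDivisor X),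
    (∀ i, 0 < a i) ∧ (∀ i, IsAmpleOver f (H i)) ∧ A = ∑ i, a i ⊗ₜ[ℤ] H i

/-- A morphism is quasi-projective if it is of finite type and there is a divisor on its
source which is ample over its target. -/
structure IsQuasiProjective {X S : Scheme.{u}} [IsIntegral X] (f : X ⟶ S) : Prop where
  locallyOfFiniteType : LocallyOfFiniteType f
  quasiCompact : QuasiCompact f
  exists_ample : ∃ D : CartierDivisor X, IsAmpleOver f D

/-! ## Varieties and contractions -/

/-- Normal quasi-projective varieties over `ℂ`. -/
structure Variety where
  carrier : Scheme.{0}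
  str : carrier ⟶ Spec (CommRingCat.of ℂ)
  isIntegral : IsIntegral carrier
  isSeparated : IsSeparated str
  isNormal : ∀ x : carrier, IsIntegrallyClosed (carrier.presheaf.stalk x)
  isQuasiProjective : IsQuasiProjective str

attribute [instance] Variety.isIntegral

/-- Contractions: projective (i.e. proper and quasi-projective) morphisms `f : X → Y` over `ℂ` such
that the natural map `𝒪_Y → f_* 𝒪_X` is an isomorphism. -/
structure Contraction (X Y : Variety) where
  hom : X.carrier ⟶ Y.carrier
  w : hom ≫ Y.str = X.str
  isProper : IsProper hom
  isQuasiProjective : IsQuasiProjective hom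
  isIso_app : ∀ U : Y.carrier.Opens, IsIso (hom.app U)

instance Contraction.isDominant {X Y : Variety} (f : Contraction X Y) : IsDominant f.hom := by
  refine ⟨dense_iff_inter_open.mpr fun U hU hne => ?_⟩
  by_contra hcon
  let V : Y.carrier.Opens := ⟨U, hU⟩
  have hV : Nonempty V := ⟨⟨hne.some, hne.some_mem⟩⟩
  have hbot : f.hom ⁻¹ᵁ V = ⊥ := by
    ext x
    simp only [TopologicalSpace.Opens.coe_bot, Set.mem_empty_iff_false, iff_false]
    exact fun hx => hcon ⟨_, hx, x, rfl⟩
  have h1 : Subsingleton Γ(X.carrier, f.hom ⁻¹ᵁ V) := by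
    rw [hbot]; infer_instance
  have := f.isIso_app V
  have h2 : Subsingleton Γ(Y.carrier, V) :=
    (ConcreteCategory.bijective_of_isIso (f.hom.app V)).1.subsingleton
  exact not_subsingleton Γ(Y.carrier, V) h2

/-- `Xbar`, with the contractions `hbar : Xbar → X` and `fbar : Xbar → Z`, is a core model of the
pair of contractions `h : X' → X` and `f : X' → Z`. -/
structure IsCoreModel {X' X Z Xbar : Variety} (h : Contraction X' X) (f : Contraction X' Z)
    (hbar : Contraction Xbar X) (fbar : Contraction Xbar Z) : Prop where
  ample : ∀ A : RCartierDivisor X.carrier, IsRAmpleOver X.str A →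
    IsRAmpleOver fbar.hom (pullbackRCartier hbar.hom A)
  factor : ∃ g : Contraction X' Xbar, g.hom ≫ hbar.hom = h.hom ∧ g.hom ≫ fbar.hom = f.hom

end CoreModel

end

open CategoryTheory AlgebraicGeometry
open scoped TensorProduct

noncomputable section

namespace CoreModel

universe u

/-! Put `T = X × Z`. The contractions `h` and `f` give a proper morphism `p : X' ⟶ T`, and the core
model is the middle term of its Stein factorization, realized as the relative normalization of `T`
in `X'`.

Existence. Over an affine open of `T`, the sections of `p_* 𝒪` are integral (`p` is universally
closed) and embed in an algebra of finite type, hence form a finite algebra in characteristic zero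
(`finite_of_isIntegral_of_finiteType`). So the normalization is finite over `T`; it is normal
because `g_* 𝒪 = 𝒪`. Preimages of boxes `V × W` are affine, so non-vanishing loci of sections pulled
back from `X` are affine over affine opens of `Z`: this is condition (1).

Uniqueness. Conversely, (1) forces finiteness over `T` (`isFinite_lift`). The real combination in
(1) is first replaced by an integral one (`exists_nsmul_eq_sum`). Over a box where an ample divisor
of `X` is principal, a multiple of its pullback is then both ample and principal, so the preimage is
quasi-affine; being proper over an affine scheme, it is affine. Proper and affine means finite.
Condition (2) makes `K(Xbar)` algebraically closed in `K(X')`, so the normal scheme `Xbar` is the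
normalization of `T` in the point `Spec K(X') ⟶ T` (`isIso_normalizationDesc`) and depends on that
point only.

Invariance. A map `φ` over `X` and `Z` gives a point `Spec K(X') ⟶ X''` with the same image in `T`,
and algebraic closedness composes. The core models of both pairs are therefore the same
normalization. -/

/-! ## Finiteness of integral closures inside algebras of finite type -/

/-- Let `P` be a Noetherian integrally closed domain of characteristic zero. A domain which is
integral over `P` and embeds in a `P`-algebra of finite type is finite over `P`. -/
lemma finite_of_isIntegral_of_isIntegrallyClosed {P B R : Type u} [CommRing P] [IsDomain P]
    [CharZero P] [IsNoetherianRing P] [IsIntegrallyClosed P] [CommRing B] [IsDomain B]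
    [CommRing R] [IsDomain R] [Algebra P B] [Algebra B R] [Algebra P R] [IsScalarTower P B R]
    [Algebra.IsIntegral P B] [Algebra.FiniteType P R] [FaithfulSMul P B] [FaithfulSMul B R] :
    Module.Finite P B := by
  have : FaithfulSMul P R := FaithfulSMul.trans P B R
  let F := FractionRing P
  let L := FractionRing B
  let M := Algebra.algebraMapSubmonoid R (nonZeroDivisors P)
  have hM : M ≤ nonZeroDivisors R :=
    map_le_nonZeroDivisors_of_injective _ (FaithfulSMul.algebraMap_injective P R) le_rfl
  let RF := Localization M
  have : IsLocalization ((nonZeroDivisors P).map (algebraMap P R)) RF :=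
    inferInstanceAs (IsLocalization M (Localization M))
  have : IsDomain RF := IsLocalization.isDomain_localization hM
  let : Algebra F L := FractionRing.liftAlgebra P L
  let : Algebra F RF := localizationAlgebra (nonZeroDivisors P) R
  have hcomp : (algebraMap F RF).comp (algebraMap P F) = (algebraMap R RF).comp (algebraMap P R) :=
    IsLocalization.map_comp (T := M) _
  have hft : (algebraMap F RF).FiniteType :=
    RingHom.finiteType_localizationPreserves (algebraMap P R) (nonZeroDivisors P) F RF
      (RingHom.finiteType_algebraMap.mpr ‹_›)
  -- `B` is algebraic over `P`, so each nonzero element of `B` divides a nonzero element of `P` and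
  -- becomes invertible in `RF`.
  let ψ : L →+* RF := IsLocalization.lift (M := nonZeroDivisors B)
    (g := (algebraMap R RF).comp (algebraMap B R)) fun y => by
      obtain ⟨p, hp, c, hc⟩ :=
        (Algebra.IsIntegral.isIntegral (R := P) y.1).isAlgebraic.exists_nonzero_dvd
        y.2
      refine isUnit_of_dvd_unit (y := algebraMap R RF (algebraMap P R p))
        ⟨algebraMap R RF (algebraMap B R c), ?_⟩
        (IsLocalization.map_units RF (⟨_, p, mem_nonZeroDivisors_of_ne_zero hp, rfl⟩ : M))
      rw [IsScalarTower.algebraMap_apply P B R, hc]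
      simp
  -- Zariski's lemma: the field `L` maps to the nonzero `F`-algebra `RF` of finite type.
  have : Module.Finite F L := by
    refine RingHom.finite_algebraMap.mp
      (RingHom.finite_of_algHom_finiteType_of_isJacobsonRing (algebraMap F L) ψ ?_)
    convert hft
    refine IsLocalization.ringHom_ext (nonZeroDivisors P) ?_
    rw [hcomp, RingHom.comp_assoc, ← IsScalarTower.algebraMap_eq P F L,
      IsScalarTower.algebraMap_eq P B L, ← RingHom.comp_assoc, IsLocalization.lift_comp,
      RingHom.comp_assoc, ← IsScalarTower.algebraMap_eq]
  have : CharZero F := charZero_of_injective_algebraMap (IsFractionRing.injective P F)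
  -- In characteristic zero `L / F` is separable, so the integral closure of `P` in `L`, which
  -- contains `B`, is a Noetherian module.
  have := IsIntegralClosure.isNoetherian P F L (integralClosure P L)
  let ι : B →ₐ[P] integralClosure P L :=
    (IsScalarTower.toAlgHom P B L).codRestrict _ fun b =>
      (Algebra.IsIntegral.isIntegral (R := P) b).map (IsScalarTower.toAlgHom P B L)
  exact Module.Finite.of_injective ι.toLinearMap fun x y hxy =>
    IsFractionRing.injective B L congr(($hxy).1)

/-- A domain which is integral over a finitely generated algebra `A` over a field of characteristic
zero, and which embeds in an `A`-algebra domain of finite type, is finite over `A`. -/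
lemma finite_of_isIntegral_of_finiteType (k : Type u) {A B R : Type u} [Field k] [CharZero k]
    [CommRing A] [Algebra k A] [Algebra.FiniteType k A] [CommRing B] [IsDomain B] [CommRing R]
    [IsDomain R] [Algebra A B] [Algebra B R] [Algebra A R] [IsScalarTower A B R]
    [Algebra.IsIntegral A B] [Algebra.FiniteType A R] [FaithfulSMul B R] :
    Module.Finite A B := by
  -- `A` need not inject into `B`. Its image does, and Noether normalization of the image supplies
  -- the integrally closed base `P`.
  let A' := (algebraMap A B).range
  let : Algebra k A' := ((algebraMap A B).rangeRestrict.comp (algebraMap k A)).toAlgebra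
  have : Algebra.FiniteType k A' :=
    Algebra.FiniteType.of_surjective (R := k) (A := A)
      { (algebraMap A B).rangeRestrict with commutes' := fun _ => rfl }
      (algebraMap A B).rangeRestrict_surjective
  obtain ⟨s, g, hg, hgf⟩ := exists_finite_inj_algHom_of_fg k A'
  let P := MvPolynomial (Fin s) k
  let : Algebra P A' := g.toRingHom.toAlgebra
  let : Algebra P B := ((algebraMap A' B).comp g.toRingHom).toAlgebra
  let : Algebra P R := ((algebraMap B R).comp (algebraMap P B)).toAlgebra
  have : IsScalarTower P A' B := .of_algebraMap_eq' rfl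
  have : IsScalarTower P B R := .of_algebraMap_eq' rfl
  have : Module.Finite P A' := hgf
  let : Algebra A A' := (algebraMap A B).rangeRestrict.toAlgebra
  have : IsScalarTower A A' B := .of_algebraMap_eq' rfl
  have : Algebra.IsIntegral A' B := Algebra.IsIntegral.tower_top A
  have : Algebra.IsIntegral P B := Algebra.IsIntegral.trans A'
  let : Algebra A' R := ((algebraMap B R).comp (algebraMap A' B)).toAlgebra
  have : IsScalarTower P A' R := .of_algebraMap_eq' rfl
  have : IsScalarTower A A' R := .of_algebraMap_eq' (IsScalarTower.algebraMap_eq A B R)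
  have : Algebra.FiniteType A' R := Algebra.FiniteType.of_restrictScalars_finiteType A A' R
  have : Algebra.FiniteType P R := Algebra.FiniteType.trans (S := A') inferInstance inferInstance
  have : FaithfulSMul P B := (faithfulSMul_iff_algebraMap_injective _ _).mpr
    (Subtype.val_injective.comp hg)
  have : Module.Finite P B := finite_of_isIntegral_of_isIntegrallyClosed (R := R)
  have : Module.Finite A' B := Module.Finite.of_restrictScalars_finite P A' B
  have : Module.Finite A A' := Module.Finite.of_surjective (Algebra.linearMap A A')
    (algebraMap A B).rangeRestrict_surjective
  exact Module.Finite.trans A' B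

/-! ## Sections and rational functions -/

lemma nonempty_inf {X : Scheme.{u}} [IsIntegral X] {U V : X.Opens} [Nonempty U]
    [Nonempty V] : Nonempty (U ⊓ V : X.Opens) := by
  have h (W : X.Opens) [h : Nonempty W] : genericPoint X ∈ W :=
    ((genericPoint_spec X).mem_open_set_iff W.isOpen).mpr (by simpa using h)
  exact ⟨⟨genericPoint X, h U, h V⟩⟩

lemma germToFunctionField_map {X : Scheme.{u}} [IsIntegral X] {U V : X.Opens} [Nonempty U]
    [Nonempty V] (i : U ⟶ V) (s : Γ(X, V)) :
    X.germToFunctionField U (X.presheaf.map i.op s) = X.germToFunctionField V s :=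
  X.presheaf.germ_res_apply i _ _ s

/-- A rational function which is regular at all points of a nonempty open subset is a section. -/
lemma exists_germToFunctionField_eq {X : Scheme.{u}} [IsIntegral X] (U : X.Opens) [Nonempty U]
    (a : X.functionField)
    (h : ∀ x ∈ U, a ∈ (algebraMap (X.presheaf.stalk x) X.functionField).range) :
    ∃ s : Γ(X, U), X.germToFunctionField U s = a := by
  have h' (x : U) : ∃ (V : X.Opens) (_ : x.1 ∈ V) (_ : V ≤ U) (_ : Nonempty V) (s : Γ(X, V)),
      X.germToFunctionField V s = a := by
    obtain ⟨t, ht⟩ := h x x.2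
    obtain ⟨V, hV, s, rfl⟩ := X.presheaf.exists_germ_eq t
    have hVU : Nonempty (V ⊓ U : X.Opens) := ⟨⟨x.1, hV, x.2⟩⟩
    have : Nonempty V := ⟨⟨x.1, hV⟩⟩
    refine ⟨V ⊓ U, ⟨hV, x.2⟩, inf_le_right, hVU,
      X.presheaf.map (TopologicalSpace.Opens.infLELeft V U).op s, ?_⟩
    rw [germToFunctionField_map, ← ht, Scheme.algebraMap_germ_eq_germToFunctionField]
  choose V hxV hVU hV s hs using h'
  obtain ⟨t, ht, -⟩ := X.sheaf.existsUnique_gluing' V U (fun i => homOfLE (hVU i))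
    (fun x hx => TopologicalSpace.Opens.mem_iSup.mpr ⟨⟨x, hx⟩, hxV _⟩) s (fun i j => by
      have := nonempty_inf (U := V i) (V := V j)
      apply X.germToFunctionField_injective (V i ⊓ V j)
      exact (germToFunctionField_map _ _).trans
        ((hs i).trans ((germToFunctionField_map _ _).trans (hs j)).symm))
  obtain ⟨x⟩ := ‹Nonempty U›
  have := hV x
  refine ⟨t, ?_⟩
  rw [← hs x, ← ht x]
  exact (germToFunctionField_map (homOfLE (hVU x)) t).symm

/-- Over a normal integral scheme, a rational function which is integral over the sections over an
open subset is itself a section. -/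
lemma isIntegrallyClosedIn_functionField {X : Scheme.{u}} [IsIntegral X]
    (hX : ∀ x : X, IsIntegrallyClosed (X.presheaf.stalk x)) (U : X.Opens) [Nonempty U] :
    IsIntegrallyClosedIn Γ(X, U) X.functionField := by
  refine isIntegrallyClosedIn_iff.mpr ⟨X.germToFunctionField_injective U, fun {a} ha => ?_⟩
  refine exists_germToFunctionField_eq U a fun x hx => ?_
  let := X.presheaf.algebra_section_stalk ⟨x, hx⟩
  have := functionField_isScalarTower X U ⟨x, hx⟩
  have := hX x
  exact IsIntegrallyClosed.isIntegral_iff.mp (ha.tower_top (A := X.presheaf.stalk x))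

/-! ## Field-valued points at the generic point -/

/-- The ring homomorphism `K(Y) → K` induced by a morphism `Spec K ⟶ Y` hitting the generic
point. -/
def genericPointMap {Y : Scheme.{u}} [IsIntegral Y] {K : CommRingCat.{u}} [IsLocalRing K]
    (η : Spec K ⟶ Y) (hη : η (IsLocalRing.closedPoint K) = genericPoint Y) :
    Y.functionField →+* K :=
  (Y.presheaf.stalkSpecializes (specializes_of_eq hη) ≫ Scheme.stalkClosedPointTo η).hom

lemma genericPointMap_germ {Y : Scheme.{u}} [IsIntegral Y] {K : CommRingCat.{u}} [IsLocalRing K]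
    (η : Spec K ⟶ Y) (hη : η (IsLocalRing.closedPoint K) = genericPoint Y)
    (U : Y.Opens) (h : genericPoint Y ∈ U) (s : Γ(Y, U)) :
    genericPointMap η hη (Y.presheaf.germ U _ h s) =
      (Scheme.ΓSpecIso K).hom ((η.appLE U ⊤
        (Scheme.preimage_eq_top_of_closedPoint_mem η (hη ▸ h)).ge) s) := by
  have := Scheme.germ_stalkClosedPointTo η U (hη ▸ h)
  rw [genericPointMap, ← CommRingCat.comp_apply, TopCat.Presheaf.germ_stalkSpecializes_assoc, this]
  rfl

lemma genericPoint_mem {X : Scheme.{u}} [IsIntegral X] (U : X.Opens) [h : Nonempty U] :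
    genericPoint X ∈ U :=
  ((genericPoint_spec X).mem_open_set_iff U.isOpen).mpr (by simpa using h)

lemma functionFieldMap_germ {X Y : Scheme.{u}} [IsIntegral X] [IsIntegral Y] (f : X ⟶ Y)
    [IsDominant f] (U : Y.Opens) (h : genericPoint Y ∈ U) (s : Γ(Y, U)) :
    functionFieldMap f (Y.presheaf.germ U _ h s) =
      X.presheaf.germ (f ⁻¹ᵁ U) (genericPoint X)
        (show f (genericPoint X) ∈ U from map_genericPoint f ▸ h) (f.app U s) := by
  rw [functionFieldMap, ← CommRingCat.comp_apply, TopCat.Presheaf.germ_stalkSpecializes_assoc,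
    Scheme.Hom.germ_stalkMap]
  rfl

/-- Two ring homomorphisms out of the function field agree if they agree on germs of sections. -/
lemma functionField_hom_ext {Y : Scheme.{u}} [IsIntegral Y] {R : Type*} [CommRing R]
    {φ ψ : Y.functionField →+* R}
    (h : ∀ (U : Y.Opens) (hU : genericPoint Y ∈ U) (s : Γ(Y, U)),
      φ (Y.presheaf.germ U _ hU s) = ψ (Y.presheaf.germ U _ hU s)) : φ = ψ := by
  ext x
  obtain ⟨U, hU, s, rfl⟩ := Y.presheaf.exists_germ_eq x
  exact h U hU s

/-- The composition of a generic point with a dominant morphism. -/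
lemma genericPointMap_comp {Y Z : Scheme.{u}} [IsIntegral Y] [IsIntegral Z] {K : CommRingCat.{u}}
    [IsLocalRing K] (η : Spec K ⟶ Y) (hη : η (IsLocalRing.closedPoint K) = genericPoint Y)
    (f : Y ⟶ Z) [IsDominant f] (h : (η ≫ f) (IsLocalRing.closedPoint K) = genericPoint Z) :
    genericPointMap (η ≫ f) h = (genericPointMap η hη).comp (functionFieldMap f) := by
  refine functionField_hom_ext fun U hU s => ?_
  rw [genericPointMap_germ, RingHom.comp_apply, functionFieldMap_germ]
  refine Eq.trans ?_ (genericPointMap_germ η hη _ _ _).symm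
  rw [← CommRingCat.comp_apply (f.app U), Scheme.Hom.app_eq_appLE, Scheme.Hom.appLE_comp_appLE]

/-- The generic point of `X` as a morphism `Spec K(X) ⟶ X` induces the identity of `K(X)`. -/
lemma genericPointMap_fromSpecStalk {X : Scheme.{u}} [IsIntegral X]
    (h : X.fromSpecStalk (genericPoint X) (IsLocalRing.closedPoint X.functionField) =
      genericPoint X) (a : X.functionField) :
    genericPointMap (X.fromSpecStalk (genericPoint X)) h a = a := by
  refine congr($(functionField_hom_ext (ψ := RingHom.id _) fun U hU s => ?_) a)
  rw [genericPointMap, Scheme.stalkClosedPointTo_fromSpecStalk, ← CommRingCat.comp_apply]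
  simp only [TopCat.Presheaf.stalkCongr_hom, TopCat.Presheaf.germ_stalkSpecializes_assoc]
  exact congr($(X.presheaf.germ_stalkSpecializes _ _).hom s)

/-- `K(Y)` is algebraically closed in `K` along the homomorphism `φ`. -/
def AlgClosedAlong {F K : Type*} [CommRing F] [CommRing K] (φ : F →+* K) : Prop :=
  ∀ x : K, (∃ p : Polynomial F, p ≠ 0 ∧ p.eval₂ φ x = 0) → x ∈ φ.range

lemma algClosedAlong_of_surjective {F K : Type*} [CommRing F] [CommRing K] (φ : F →+* K)
    (h : Function.Surjective φ) : AlgClosedAlong φ := fun x _ => h x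

/-- An equation over `E` is also one over `F`, so the root comes from `F`; injectivity of `ψ`
carries the equation back to `F`. -/
lemma AlgClosedAlong.comp {E F K : Type*} [Field E] [Field F] [CommRing K] [Nontrivial K]
    {φ : E →+* F} {ψ : F →+* K} (hψ : AlgClosedAlong ψ) (hφ : AlgClosedAlong φ) :
    AlgClosedAlong (ψ.comp φ) := by
  rintro x ⟨p, hp, hpx⟩
  obtain ⟨y, rfl⟩ := hψ x ⟨p.map φ, (Polynomial.map_ne_zero_iff φ.injective).mpr hp,
    by rwa [Polynomial.eval₂_map]⟩
  obtain ⟨z, rfl⟩ := hφ y ⟨p, hp, by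
    rw [← Polynomial.hom_eval₂] at hpx
    exact (map_eq_zero_iff ψ ψ.injective).mp hpx⟩
  exact ⟨z, rfl⟩

/-- A contraction from a normal integral scheme has algebraically closed function field. -/
lemma algClosedAlong_functionFieldMap {X Y : Scheme.{u}} [IsIntegral X] [IsIntegral Y]
    (hX : ∀ x : X, IsIntegrallyClosed (X.presheaf.stalk x)) (f : X ⟶ Y) [IsDominant f]
    (hf : ∀ U : Y.Opens, IsIso (f.app U)) : AlgClosedAlong (functionFieldMap f) := by
  rintro x ⟨p, hp, hpx⟩
  obtain ⟨_, ⟨U, hU, rfl⟩, hxU, -⟩ :=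
    Y.isBasis_affineOpens.exists_subset_of_mem_open (Set.mem_univ (genericPoint Y)) isOpen_univ
  have : Nonempty U := ⟨⟨_, hxU⟩⟩
  have : Nonempty (f ⁻¹ᵁ U) := ⟨⟨genericPoint X, show f _ ∈ U from map_genericPoint f ▸ hxU⟩⟩
  have := functionField_isFractionRing_of_isAffineOpen Y U hU
  let : Algebra Γ(Y, U) X.functionField :=
    ((functionFieldMap f).comp (Y.germToFunctionField U).hom).toAlgebra
  let : Algebra Y.functionField X.functionField := (functionFieldMap f).toAlgebra
  have : IsScalarTower Γ(Y, U) Y.functionField X.functionField := .of_algebraMap_eq' rfl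
  let : Algebra Γ(Y, U) Γ(X, f ⁻¹ᵁ U) := (f.app U).hom.toAlgebra
  have : IsScalarTower Γ(Y, U) Γ(X, f ⁻¹ᵁ U) X.functionField :=
    .of_algebraMap_eq fun s => functionFieldMap_germ f U hxU s
  have hx : IsAlgebraic Y.functionField x := ⟨p, hp, hpx⟩
  -- Clearing denominators makes `b • x` integral over `Γ(Y, U)`. By normality of `X` it is a
  -- section over `f ⁻¹ᵁ U`, and `f_* 𝒪 = 𝒪` brings it down to `Y`.
  obtain ⟨b, hb, hbx⟩ := ((IsFractionRing.isAlgebraic_iff Γ(Y, U) Y.functionField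
    X.functionField).mpr hx).exists_integral_multiple
  have := isIntegrallyClosedIn_functionField hX (f ⁻¹ᵁ U)
  obtain ⟨t, ht⟩ := IsIntegrallyClosedIn.isIntegral_iff.mp
    (hbx.tower_top (A := Γ(X, f ⁻¹ᵁ U)))
  have := hf U
  obtain ⟨s, hs⟩ := (ConcreteCategory.bijective_of_isIso (f.app U)).2 t
  have hs' : functionFieldMap f (Y.germToFunctionField U s) = b • x := by
    rw [← ht, ← hs]
    exact functionFieldMap_germ f U hxU s
  have hb' : Y.germToFunctionField U b ≠ 0 := fun h0 =>
    hb (Y.germToFunctionField_injective U (h0.trans (map_zero _).symm))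
  refine ⟨(Y.germToFunctionField U b)⁻¹ * Y.germToFunctionField U s, ?_⟩
  rw [map_mul, map_inv₀, hs', Algebra.smul_def]
  exact inv_mul_cancel_left₀ ((map_ne_zero _).mpr hb') x

lemma rationalFunctionFieldMap_toRationalMap {X Y : Scheme.{u}} [IsIntegral X] [IsIntegral Y]
    (f : X ⟶ Y) [IsDominant f] [f.toRationalMap.IsDominant] (a : Y.functionField) :
    rationalFunctionFieldMap f.toRationalMap a = functionFieldMap f a := by
  have h0 : X.fromSpecStalk (genericPoint X) (IsLocalRing.closedPoint X.functionField) =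
      genericPoint X := Scheme.fromSpecStalk_closedPoint
  have h1 : f.toRationalMap.fromFunctionField = X.fromSpecStalk (genericPoint X) ≫ f :=
    Scheme.PartialMap.fromSpecStalkOfMem_toPartialMap f _
  have h2 := fromFunctionField_closedPoint f.toRationalMap
  change genericPointMap f.toRationalMap.fromFunctionField h2 a = _
  -- `h2` depends on the morphism, so `h1` is substituted instead of rewritten.
  generalize f.toRationalMap.fromFunctionField = η at h1 h2
  subst h1
  rw [genericPointMap_comp _ h0, RingHom.comp_apply, genericPointMap_fromSpecStalk]

/-! ## Normal schemes as relative normalizations -/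

/-- A morphism `d` between schemes affine over `T` is an isomorphism if it is bijective on
sections over the preimages of the affine open subsets of `T`. -/
lemma isIso_of_bijective_app {N Y T : Scheme.{u}} (d : N ⟶ Y) [IsAffineHom d] (q : Y ⟶ T)
    [IsAffineHom q]
    (h : ∀ U : T.Opens, IsAffineOpen U → Function.Bijective (d.app (q ⁻¹ᵁ U))) : IsIso d := by
  refine (IsZariskiLocalAtTarget.iff_of_iSup_eq_top (P := .isomorphisms Scheme)
    (fun U : T.affineOpens => q ⁻¹ᵁ U.1) (TopologicalSpace.IsOpenCover.comap
      (iSup_affineOpens_eq_top T) q.base.hom)).mpr fun U => ?_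
  exact (isIso_morphismRestrict_iff_isIso_app d (U.2.preimage q)).mpr
    ((ConcreteCategory.isIso_iff_bijective _).mpr (h U.1 U.2))

/-- The sections of the relative normalization over the preimage of an affine open subset are the
integral elements. -/
lemma toNormalization_appLE {X T : Scheme.{u}} (p : X ⟶ T) [QuasiCompact p] [QuasiSeparated p]
    {U : T.Opens} (hU : IsAffineOpen U) {V : p.normalization.Opens}
    (hV : V = p.fromNormalization ⁻¹ᵁ U) (hVU : p ⁻¹ᵁ U ≤ p.toNormalization ⁻¹ᵁ V) :
    Function.Injective (p.toNormalization.appLE V (p ⁻¹ᵁ U) hVU) ∧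
      ∀ x, x ∈ (p.toNormalization.appLE V (p ⁻¹ᵁ U) hVU).hom.range ↔
        (p.app U).hom.IsIntegralElem x := by
  subst hV
  let := (p.app U).hom.toAlgebra
  rw [← p.normalizationObjIso_hom_val hU]
  have hb := ConcreteCategory.bijective_of_isIso (p.normalizationObjIso hU).hom
  refine ⟨fun x y hxy => hb.1 (Subtype.val_injective hxy), fun x => ⟨?_, fun hx => ?_⟩⟩
  · rintro ⟨y, rfl⟩
    exact ((p.normalizationObjIso hU).hom y).2
  · obtain ⟨y, hy⟩ := hb.2 ⟨x, hx⟩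
    exact ⟨y, congr(($hy).1)⟩

/-- A normal integral scheme `Y` which is integral over `T` is the normalization of `T` in any
field-valued generic point of `Y` along which `K(Y)` is algebraically closed. -/
lemma isIso_normalizationDesc {Y T : Scheme.{u}} [IsIntegral Y]
    (hY : ∀ y : Y, IsIntegrallyClosed (Y.presheaf.stalk y)) (q : Y ⟶ T) [IsIntegralHom q]
    {K : CommRingCat.{u}} [IsLocalRing K] (η : Spec K ⟶ Y)
    (hη : η (IsLocalRing.closedPoint K) = genericPoint Y)
    (hK : AlgClosedAlong (genericPointMap η hη)) [QuasiCompact (η ≫ q)]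
    [QuasiSeparated (η ≫ q)] :
    IsIso ((η ≫ q).normalizationDesc η q rfl) := by
  refine isIso_of_bijective_app _ q fun U hU => ?_
  set d := (η ≫ q).normalizationDesc η q rfl with hd
  have hdq : d ≫ q = (η ≫ q).fromNormalization := Scheme.Hom.normalizationDesc_comp ..
  have htd : (η ≫ q).toNormalization ≫ d = η := Scheme.Hom.toNormalization_normalizationDesc ..
  obtain hne | hemp := (q ⁻¹ᵁ U : Set Y).eq_empty_or_nonempty.symm
  · have hne' : Nonempty (q ⁻¹ᵁ U) := hne.to_subtype
    have hmem : η (IsLocalRing.closedPoint K) ∈ q ⁻¹ᵁ U := hη ▸ genericPoint_mem (q ⁻¹ᵁ U)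
    have htop : η ⁻¹ᵁ q ⁻¹ᵁ U = ⊤ := Scheme.preimage_eq_top_of_closedPoint_mem η hmem
    have htop' : (η ≫ q) ⁻¹ᵁ U = ⊤ := htop
    obtain ⟨htinj, htrange⟩ := toNormalization_appLE (η ≫ q) hU (V := d ⁻¹ᵁ q ⁻¹ᵁ U)
      (by rw [← hdq]; rfl) (by rw [← Scheme.Hom.comp_preimage, htd]; rfl)
    set t := (η ≫ q).toNormalization.appLE (d ⁻¹ᵁ q ⁻¹ᵁ U) ((η ≫ q) ⁻¹ᵁ U)
      (by rw [← Scheme.Hom.comp_preimage, htd]; rfl) with ht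
    have hta (s : Γ(Y, q ⁻¹ᵁ U)) : t (d.app (q ⁻¹ᵁ U) s) = η.app (q ⁻¹ᵁ U) s := by
      rw [← CommRingCat.comp_apply, ht, Scheme.Hom.app_eq_appLE, Scheme.Hom.appLE_comp_appLE]
      simp only [htd, Scheme.Hom.app_eq_appLE]
      rfl
    let r : Γ(Spec K, (η ≫ q) ⁻¹ᵁ U) ⟶ K :=
      (Spec K).presheaf.map (eqToHom htop'.symm).op ≫ (Scheme.ΓSpecIso K).hom
    have hr : Function.Injective r := (ConcreteCategory.bijective_of_isIso r).1
    have hrη (s : Γ(Y, q ⁻¹ᵁ U)) : r (η.app (q ⁻¹ᵁ U) s) =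
        genericPointMap η hη (Y.germToFunctionField (q ⁻¹ᵁ U) s) :=
      (genericPointMap_germ η hη _ (genericPoint_mem _) s).symm
    constructor
    · intro s s' hss
      refine Y.germToFunctionField_injective (q ⁻¹ᵁ U) ((genericPointMap η hη).injective ?_)
      rw [← hrη, ← hrη, ← hta, ← hta, hss]
    -- `n` is integral over `Γ(T, U)`, so its image in `K` is algebraic over `K(Y)` and comes from
    -- some `y` in `K(Y)`. This `y` is integral over the sections of `Y`, hence a section by
    -- normality.
    · intro n
      obtain ⟨P, hP, hPx⟩ := (htrange (t n)).mp ⟨n, rfl⟩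
      have hev : ((P.map (q.app U).hom).map (Y.germToFunctionField (q ⁻¹ᵁ U)).hom).eval₂
          (genericPointMap η hη) (r (t n)) = 0 := by
        have h1 := congr(r.hom $hPx)
        rw [Polynomial.hom_eval₂, map_zero] at h1
        rw [Polynomial.eval₂_map, Polynomial.eval₂_map, ← h1]
        congr 1
        ext s
        exact (hrη _).symm
      obtain ⟨y, hy⟩ := hK (r (t n)) ⟨_, ((hP.map _).map _).ne_zero, hev⟩
      have := isIntegrallyClosedIn_functionField hY (q ⁻¹ᵁ U)
      obtain ⟨s, hs⟩ := IsIntegrallyClosedIn.isIntegral_iff.mp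
        (show IsIntegral Γ(Y, q ⁻¹ᵁ U) y from ⟨P.map (q.app U).hom, hP.map _, by
          rw [← hy, Polynomial.eval₂_hom, map_eq_zero_iff _ (genericPointMap η hη).injective,
            Polynomial.eval_map] at hev
          exact hev⟩)
      refine ⟨s, htinj (hr ?_)⟩
      rw [hta, hrη, ← hy, ← hs]
      rfl
  · have h1 : q ⁻¹ᵁ U = ⊥ := TopologicalSpace.Opens.ext hemp
    have h2 : Subsingleton Γ(Y, q ⁻¹ᵁ U) := by rw [h1]; infer_instance
    have h3 : Subsingleton Γ((η ≫ q).normalization, d ⁻¹ᵁ q ⁻¹ᵁ U) := by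
      rw [h1]; exact inferInstanceAs (Subsingleton Γ((η ≫ q).normalization, ⊥))
    exact ⟨Function.injective_of_subsingleton _, Function.surjective_to_subsingleton _⟩

/-! ## Local sections of the sheaves `𝒪_X(D)` -/

section LocalSections

variable {X : Scheme.{u}} [IsIntegral X]

lemma IsLocalEquation.add {D E : CartierDivisor X} {x : X} {d e : X.functionFieldˣ}
    (hd : IsLocalEquation D x d) (he : IsLocalEquation E x e) :
    IsLocalEquation (D + E) x (d * e) := by
  change D.1 x + E.1 x = _
  rw [hd, he]
  rfl

lemma IsLocalEquation.nsmul {D : CartierDivisor X} {x : X} {d : X.functionFieldˣ}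
    (hd : IsLocalEquation D x d) (n : ℕ) : IsLocalEquation (n • D) x (d ^ n) := by
  change n • D.1 x = _
  rw [hd]
  rfl

/-- Two local equations differ by a unit. -/
lemma IsLocalEquation.exists_unit {D : CartierDivisor X} {x : X} {d e : X.functionFieldˣ}
    (hd : IsLocalEquation D x d) (he : IsLocalEquation D x e) :
    ∃ u : (X.presheaf.stalk x)ˣ, (e : X.functionField) =
      algebraMap (X.presheaf.stalk x) X.functionField u * d := by
  obtain ⟨u, hu⟩ := QuotientGroup.eq.mp (Additive.ofMul.injective (hd.symm.trans he))
  refine ⟨u, ?_⟩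
  have h := congr((d * $hu : X.functionFieldˣ).1)
  rw [mul_inv_cancel_left, mul_comm] at h
  exact h.symm

/-- `s` is a section of `𝒪_X(D)` at the point `y`. -/
def IsSectionAt (D : CartierDivisor X) (s : X.functionField) (y : X) : Prop :=
  ∃ d, IsLocalEquation D y d ∧
    ∃ a : X.presheaf.stalk y, algebraMap (X.presheaf.stalk y) X.functionField a = s * d

lemma IsSectionAt.exists_eq {D : CartierDivisor X} {s : X.functionField} {y : X}
    (h : IsSectionAt D s y) {e : X.functionFieldˣ} (he : IsLocalEquation D y e) :
    ∃ a : X.presheaf.stalk y, algebraMap (X.presheaf.stalk y) X.functionField a = s * e := by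
  obtain ⟨d, hd, a, ha⟩ := h
  obtain ⟨u, hu⟩ := hd.exists_unit he
  exact ⟨a * u, by rw [map_mul, ha, hu]; ring⟩

/-- Changing the local equation changes `a` by a unit. Questions about products, powers and
pullbacks of generators thus become questions about units of local rings. -/
lemma generatesAt_iff {D : CartierDivisor X} {s : X.functionField} {y : X}
    {e : X.functionFieldˣ} (he : IsLocalEquation D y e) {a : X.presheaf.stalk y}
    (ha : algebraMap (X.presheaf.stalk y) X.functionField a = s * e) :
    GeneratesAt D s y ↔ IsUnit a := by
  refine ⟨fun ⟨d, hd, b, hb, hbd⟩ => ?_, fun h => ⟨e, he, a, h, ha⟩⟩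
  obtain ⟨u, hu⟩ := hd.exists_unit he
  have : a = b * u := IsFractionRing.injective (X.presheaf.stalk y) X.functionField (by
    rw [ha, map_mul, hbd, hu]; ring)
  rw [this]
  exact hb.mul u.isUnit

lemma IsSectionAt.mul {D E : CartierDivisor X} {s t : X.functionField} {y : X}
    (hs : IsSectionAt D s y) (ht : IsSectionAt E t y) : IsSectionAt (D + E) (s * t) y := by
  obtain ⟨d, hd, a, ha⟩ := hs
  obtain ⟨e, he, b, hb⟩ := ht
  exact ⟨d * e, hd.add he, a * b, by rw [map_mul, ha, hb, Units.val_mul]; ring⟩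

lemma IsSectionAt.generatesAt_mul {D E : CartierDivisor X} {s t : X.functionField} {y : X}
    (hs : IsSectionAt D s y) (ht : IsSectionAt E t y) :
    GeneratesAt (D + E) (s * t) y ↔ GeneratesAt D s y ∧ GeneratesAt E t y := by
  obtain ⟨d, hd, a, ha⟩ := hs
  obtain ⟨e, he, b, hb⟩ := ht
  rw [generatesAt_iff hd ha, generatesAt_iff he hb, generatesAt_iff (hd.add he) (a := a * b)
    (by rw [map_mul, ha, hb, Units.val_mul]; ring), IsUnit.mul_iff]

lemma IsSectionAt.pow {D : CartierDivisor X} {s : X.functionField} {y : X}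
    (hs : IsSectionAt D s y) (n : ℕ) : IsSectionAt (n • D) (s ^ n) y := by
  obtain ⟨d, hd, a, ha⟩ := hs
  exact ⟨d ^ n, hd.nsmul n, a ^ n, by rw [map_pow, ha, Units.val_pow_eq_pow_val]; ring⟩

lemma IsSectionAt.generatesAt_pow {D : CartierDivisor X} {s : X.functionField} {y : X}
    (hs : IsSectionAt D s y) {n : ℕ} (hn : n ≠ 0) :
    GeneratesAt (n • D) (s ^ n) y ↔ GeneratesAt D s y := by
  obtain ⟨d, hd, a, ha⟩ := hs
  rw [generatesAt_iff hd ha, generatesAt_iff (hd.nsmul n) (a := a ^ n)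
    (by rw [map_pow, ha, Units.val_pow_eq_pow_val]; ring), isUnit_pow_iff hn]

lemma GeneratesAt.pow {D : CartierDivisor X} {s : X.functionField} {y : X}
    (hs : GeneratesAt D s y) (n : ℕ) : GeneratesAt (n • D) (s ^ n) y := by
  obtain ⟨d, hd, a, hu, ha⟩ := hs
  exact ⟨d ^ n, hd.nsmul n, a ^ n, hu.pow n, by rw [map_pow, ha, Units.val_pow_eq_pow_val]; ring⟩

lemma IsLocalEquation.pullback {Y : Scheme.{u}} [IsIntegral Y] {D : CartierDivisor Y}
    (f : X ⟶ Y) [IsDominant f] {x : X} {d : Y.functionFieldˣ} (hd : IsLocalEquation D (f x) d) :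
    IsLocalEquation (pullbackCartier f D) x (Units.map (functionFieldMap f).toMonoidHom d) := by
  change (pullbackGerm f x).toAdditive (D.1 (f x)) = _
  rw [hd]
  rfl

lemma IsSectionAt.pullback {Y : Scheme.{u}} [IsIntegral Y] {D : CartierDivisor Y}
    {s : Y.functionField} (f : X ⟶ Y) [IsDominant f] {x : X} (hs : IsSectionAt D s (f x)) :
    IsSectionAt (pullbackCartier f D) (functionFieldMap f s) x := by
  obtain ⟨d, hd, a, ha⟩ := hs
  refine ⟨_, hd.pullback f, f.stalkMap x a, ?_⟩
  have := functionFieldMap_algebraMap f x a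
  rw [ha, map_mul] at this
  exact this.symm

/-- The map of stalks is local, so it reflects units as well as preserving them. -/
lemma IsSectionAt.generatesAt_pullback {Y : Scheme.{u}} [IsIntegral Y] {D : CartierDivisor Y}
    {s : Y.functionField} (f : X ⟶ Y) [IsDominant f] {x : X} (hs : IsSectionAt D s (f x)) :
    GeneratesAt (pullbackCartier f D) (functionFieldMap f s) x ↔ GeneratesAt D s (f x) := by
  obtain ⟨d, hd, a, ha⟩ := hs
  have := functionFieldMap_algebraMap f x a
  rw [ha, map_mul] at this
  rw [generatesAt_iff hd ha, generatesAt_iff (hd.pullback f) (a := f.stalkMap x a) this.symm]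
  exact isUnit_map_iff (f.stalkMap x).hom a

end LocalSections

/-! ## Ample divisors -/

lemma IsAmpleOn.exists_section {X : Scheme.{u}} [IsIntegral X] {D : CartierDivisor X}
    {U : X.Opens} (h : IsAmpleOn D U) {x : X} (hx : x ∈ U) : ∃ n : ℕ, n ≠ 0 ∧
      ∃ s : X.functionField, (∀ y ∈ U, IsSectionAt (n • D) s y) ∧ GeneratesAt (n • D) s x ∧
        ∃ W : X.Opens, IsAffineOpen W ∧ ∀ y : X, y ∈ W ↔ y ∈ U ∧ GeneratesAt (n • D) s y := by
  obtain ⟨n, hn, s, hs, W, hW, hxW, hWs⟩ := h.2 x hx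
  exact ⟨n, by lia, s, hs, ((hWs x).mp hxW).2, W, hW, hWs⟩

/-- On an affine open subset over which `s` is a section of `𝒪_X(E)` and `E` has a local equation,
functions on the non-vanishing locus of `s` extend after multiplication with a power of `s`. -/
lemma exists_pow_isSectionAt {X : Scheme.{u}} [IsIntegral X] {E : CartierDivisor X}
    {V W : X.Opens} [Nonempty W] (hV : IsAffineOpen V) {e : X.functionFieldˣ}
    (he : ∀ y ∈ V, IsLocalEquation E y e) {s : X.functionField}
    (hs : ∀ y ∈ V, IsSectionAt E s y) (hW : ∀ y ∈ V, y ∈ W ↔ GeneratesAt E s y)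
    (a : Γ(X, W)) : ∃ k : ℕ, ∀ m ≥ k, ∀ y ∈ V,
      IsSectionAt (m • E) (X.germToFunctionField W a * s ^ m) y := by
  by_cases hne : Nonempty V; swap
  · exact ⟨0, fun m _ y hy => (hne ⟨⟨y, hy⟩⟩).elim⟩
  -- The equation `e` turns `s` into a regular function `b` with basic open set `V ⊓ W`, where `a`
  -- has the form `c / b ^ k`.
  obtain ⟨b, hb⟩ := exists_germToFunctionField_eq V (s * e) fun y hy => (hs y hy).exists_eq (he y hy)
  have hby (y : X) (hy : y ∈ V) : algebraMap _ X.functionField (X.presheaf.germ V y hy b) = s * e :=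
    (X.algebraMap_germ_eq_germToFunctionField hy b).trans hb
  have hbV : X.basicOpen b = V ⊓ W := by
    ext y
    refine ⟨fun hy => ?_, fun hy => ?_⟩
    · have hyV := X.basicOpen_le b hy
      exact ⟨hyV, (hW y hyV).mpr ((generatesAt_iff (he y hyV) (hby y hyV)).mpr
        ((X.mem_basicOpen b y hyV).mp hy))⟩
    · exact (X.mem_basicOpen b y hy.1).mpr ((generatesAt_iff (he y hy.1) (hby y hy.1)).mp
        ((hW y hy.1).mp hy.2))
  have hne' : Nonempty (X.basicOpen b) := hbV ▸ nonempty_inf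
  have := hV.isLocalization_basicOpen b
  have hle : X.basicOpen b ≤ W := hbV ▸ inf_le_right
  obtain ⟨⟨c, ⟨_, k, rfl⟩⟩, hck⟩ := IsLocalization.surj (Submonoid.powers b)
    (X.presheaf.map (homOfLE hle).op a)
  have hc : X.germToFunctionField W a * (s * e) ^ k = X.germToFunctionField V c := by
    have h1 := congr(X.germToFunctionField (X.basicOpen b) $hck)
    rw [map_mul, germToFunctionField_map] at h1
    refine Eq.trans ?_ (h1.trans (germToFunctionField_map (homOfLE (X.basicOpen_le b)) c))
    rw [← hb, ← map_pow]
    exact congr(_ * $((germToFunctionField_map (homOfLE (X.basicOpen_le b)) (b ^ k)).symm))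
  -- The surplus factor `b ^ (m - k)` is regular. Allowing every `m ≥ k` lets finitely many `V`
  -- share one exponent.
  refine ⟨k, fun m hm y hy => ⟨e ^ m, (he y hy).nsmul m,
    X.presheaf.germ V y hy c * X.presheaf.germ V y hy b ^ (m - k), ?_⟩⟩
  obtain ⟨j, rfl⟩ := Nat.exists_eq_add_of_le hm
  rw [map_mul, map_pow, hby, X.algebraMap_germ_eq_germToFunctionField hy, ← hc,
    Nat.add_sub_cancel_left, Units.val_pow_eq_pow_val]
  ring

/-- An ample divisor is ample on every quasi-compact open subset. -/
lemma IsAmpleOn.mono {X : Scheme.{u}} [IsIntegral X] {D : CartierDivisor X} {U V : X.Opens}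
    (h : IsAmpleOn D U) (hVU : V ≤ U) (hV : IsCompact (V : Set X)) : IsAmpleOn D V := by
  refine ⟨hV, fun x hx => ?_⟩
  obtain ⟨n, hn, s, hs, hsx, W, hW, hWs⟩ := h.exists_section (hVU hx)
  have hxW : x ∈ W := (hWs x).mpr ⟨hVU hx, hsx⟩
  have : Nonempty W := ⟨⟨x, hxW⟩⟩
  obtain ⟨a, haV, hxa⟩ := hW.exists_basicOpen_le (V := V) ⟨x, hx⟩ hxW
  -- Quasi-compactness of `V` gives a uniform power of `s` that removes the poles of `a`.
  obtain ⟨k, hk⟩ : ∃ k : ℕ, ∀ m ≥ k, ∀ y ∈ (V : Set X),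
      IsSectionAt (m • (n • D)) (X.germToFunctionField W a * s ^ m) y := by
    refine hV.induction_on (p := fun S => ∃ k : ℕ, ∀ m ≥ k, ∀ y ∈ S,
      IsSectionAt (m • (n • D)) (X.germToFunctionField W a * s ^ m) y) ⟨0, by simp⟩
      (fun S S' hS ⟨k, hk⟩ => ⟨k, fun m hm y hy => hk m hm y (hS hy)⟩)
      (fun S S' ⟨k, hk⟩ ⟨k', hk'⟩ => ⟨max k k', fun m hm y hy => hy.elim
        (hk m ((le_max_left _ _).trans hm) y) (hk' m ((le_max_right _ _).trans hm) y)⟩)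
      fun y hy => ?_
    obtain ⟨O, hyO, e, he⟩ := (n • D).2 y
    obtain ⟨_, ⟨A, hA, rfl⟩, hyA, hAO⟩ := X.isBasis_affineOpens.exists_subset_of_mem_open
      (show y ∈ O ⊓ U from ⟨hyO, hVU hy⟩) (O ⊓ U).isOpen
    obtain ⟨k, hk⟩ := exists_pow_isSectionAt hA (fun z hz => he z (hAO hz).1)
      (fun z hz => hs z (hAO hz).2)
      (fun z hz => (hWs z).trans (and_iff_right (hAO hz).2)) a
    exact ⟨A, mem_nhdsWithin_of_mem_nhds (A.isOpen.mem_nhds hyA), k, hk⟩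
  -- The extra factor `s` confines the locus to `W` even when `k = 0`. On `W`, where `s` generates,
  -- `a * s ^ k` generates exactly where `a` is invertible.
  have hloc (y : X) (hy : y ∈ V) : y ∈ X.basicOpen a ↔ y ∈ V ∧
      GeneratesAt (n • D + k • (n • D)) (s * (X.germToFunctionField W a * s ^ k)) y := by
    rw [(hs y (hVU hy)).generatesAt_mul (hk k le_rfl y hy), and_iff_right hy]
    have hg (hyW : y ∈ W) : GeneratesAt (k • (n • D)) (X.germToFunctionField W a * s ^ k) y ↔
        y ∈ X.basicOpen a := by
      obtain ⟨e, he, b, hb, hbe⟩ := ((hWs y).mp hyW).2.pow k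
      rw [X.mem_basicOpen a y hyW, generatesAt_iff he (a := X.presheaf.germ W y hyW a * b)
        (by rw [map_mul, hbe, X.algebraMap_germ_eq_germToFunctionField hyW, mul_assoc]),
        IsUnit.mul_iff, and_iff_left hb]
    refine ⟨fun hya => ?_, fun h => (hg ((hWs y).mpr ⟨hVU hy, h.1⟩)).mp h.2⟩
    have hyW := X.basicOpen_le a hya
    exact ⟨((hWs y).mp hyW).2, (hg hyW).mpr hya⟩
  have hD : n • D + k • (n • D) = (n + k * n) • D :=
    ((add_nsmul D n (k * n)).trans congr(n • D + $(mul_nsmul' D k n))).symm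
  refine ⟨n + k * n, by lia, s * (X.germToFunctionField W a * s ^ k), fun y hy => ?_,
    X.basicOpen a, hW.basicOpen a, hxa, fun y => ?_⟩
  · rw [← hD]
    exact (hs y (hVU hy)).mul (hk k le_rfl y hy)
  · rw [← hD]
    exact ⟨fun hy => (hloc y (haV hy)).mp hy, fun hy => (hloc y hy.1).mpr hy⟩

/-- Two divisors with sections having common affine non-vanishing loci have ample sum. -/
lemma isAmpleOn_add {X : Scheme.{u}} [IsIntegral X] {D E : CartierDivisor X} {U : X.Opens}
    (hU : IsCompact (U : Set X))
    (h : ∀ x ∈ U, ∃ n : ℕ, n ≠ 0 ∧ ∃ s : X.functionField, (∀ y ∈ U, IsSectionAt (n • D) s y) ∧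
      ∃ m : ℕ, m ≠ 0 ∧ ∃ t : X.functionField, (∀ y ∈ U, IsSectionAt (m • E) t y) ∧
        ∃ W : X.Opens, IsAffineOpen W ∧ x ∈ W ∧ ∀ y : X, y ∈ W ↔
          y ∈ U ∧ GeneratesAt (n • D) s y ∧ GeneratesAt (m • E) t y) : IsAmpleOn (D + E) U := by
  refine ⟨hU, fun x hx => ?_⟩
  obtain ⟨n, hn, s, hs, m, hm, t, ht, W, hW, hxW, hWst⟩ := h x hx
  have hDE : m • (n • D) + n • (m • E) = (m * n) • (D + E) :=
    ((nsmul_add D E (m * n)).trans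
      congr($(mul_nsmul' D m n) + $(mul_nsmul E m n))).symm
  -- The exponents equalize the degrees: `s ^ m` and `t ^ n` are sections for `m * n` times `D` and
  -- `E`.
  refine ⟨m * n, Nat.one_le_iff_ne_zero.mpr (mul_ne_zero hm hn), s ^ m * t ^ n, fun y hy => ?_,
    W, hW, hxW, fun y => ?_⟩
  · rw [← hDE]
    exact ((hs y hy).pow m).mul ((ht y hy).pow n)
  · rw [hWst y, ← hDE]
    refine and_congr_right fun hy => ?_
    rw [((hs y hy).pow m).generatesAt_mul ((ht y hy).pow n), (hs y hy).generatesAt_pow hm,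
      (ht y hy).generatesAt_pow hn]

lemma IsAmpleOn.add {X : Scheme.{u}} [IsIntegral X] {D E : CartierDivisor X} {U : X.Opens}
    (hX : ∀ V W : X.Opens, IsAffineOpen V → IsAffineOpen W → IsAffineOpen (V ⊓ W))
    (hD : IsAmpleOn D U) (hE : IsAmpleOn E U) : IsAmpleOn (D + E) U := by
  refine isAmpleOn_add hD.1 fun x hx => ?_
  obtain ⟨n, hn, s, hs, hsx, V, hV, hVs⟩ := hD.exists_section hx
  obtain ⟨m, hm, t, ht, htx, W, hW, hWt⟩ := hE.exists_section hx
  refine ⟨n, hn, s, hs, m, hm, t, ht, V ⊓ W, hX V W hV hW,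
    ⟨(hVs x).mpr ⟨hx, hsx⟩, (hWt x).mpr ⟨hx, htx⟩⟩, fun y => ?_⟩
  have h1 := hVs y
  have h2 := hWt y
  exact (and_congr h1 h2).trans (by tauto)

lemma IsAmpleOn.nsmul {X : Scheme.{u}} [IsIntegral X] {D : CartierDivisor X} {U : X.Opens}
    (hD : IsAmpleOn D U) {N : ℕ} (hN : N ≠ 0) : IsAmpleOn (N • D) U := by
  refine ⟨hD.1, fun x hx => ?_⟩
  obtain ⟨n, hn, s, hs, hsx, W, hW, hWs⟩ := hD.exists_section hx
  have h : n • N • D = N • n • D := smul_comm ..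
  refine ⟨n, Nat.one_le_iff_ne_zero.mpr hn, s ^ N, fun y hy => ?_, W, hW,
    (hWs x).mpr ⟨hx, hsx⟩, fun y => ?_⟩
  · rw [h]
    exact (hs y hy).pow N
  · rw [hWs y, h]
    exact and_congr_right fun hy => ((hs y hy).generatesAt_pow hN).symm

/-- The pullback of an ample divisor is relatively ample for a morphism to a product which is
affine. -/
lemma isAmpleOver_pullbackCartier {Y X Z : Scheme.{u}} [IsIntegral Y] [IsIntegral X]
    (h : Y ⟶ X) [IsDominant h] (f : Y ⟶ Z) [QuasiCompact f]
    (hf : ∀ (V : X.Opens) (W : Z.Opens), IsAffineOpen V → IsAffineOpen W →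
      IsAffineOpen (h ⁻¹ᵁ V ⊓ f ⁻¹ᵁ W))
    {D : CartierDivisor X} (hD : IsAmpleOn D ⊤) : IsAmpleOver f (pullbackCartier h D) := by
  refine fun W hW => ⟨f.isCompact_preimage hW.isCompact, fun x hx => ?_⟩
  obtain ⟨n, hn, s, hs, hsx, V, hV, hVs⟩ := hD.exists_section (x := h x) trivial
  refine ⟨n, Nat.one_le_iff_ne_zero.mpr hn, functionFieldMap h s, fun y hy => ?_,
    h ⁻¹ᵁ V ⊓ f ⁻¹ᵁ W, hf V W hV hW, ⟨(hVs _).mpr ⟨trivial, hsx⟩, hx⟩, fun y => ?_⟩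
  · rw [← map_nsmul]
    exact (hs _ trivial).pullback h
  · rw [← map_nsmul, (hs (h y) trivial).generatesAt_pullback h]
    exact ⟨fun hy => ⟨hy.2, ((hVs _).mp hy.1).2⟩, fun hy => ⟨(hVs _).mpr ⟨trivial, hy.2⟩, hy.1⟩⟩

/-- The sum of the pullbacks of ample divisors from the factors is ample for an affine morphism to
a product. -/
lemma isAmpleOn_pullbackCartier_add {Y X Z : Scheme.{u}} [IsIntegral Y] [IsIntegral X]
    [IsIntegral Z] [CompactSpace Y] (h : Y ⟶ X) [IsDominant h] (f : Y ⟶ Z) [IsDominant f]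
    (hf : ∀ (V : X.Opens) (W : Z.Opens), IsAffineOpen V → IsAffineOpen W →
      IsAffineOpen (h ⁻¹ᵁ V ⊓ f ⁻¹ᵁ W))
    {D : CartierDivisor X} (hD : IsAmpleOn D ⊤) {E : CartierDivisor Z} (hE : IsAmpleOn E ⊤) :
    IsAmpleOn (pullbackCartier h D + pullbackCartier f E) ⊤ := by
  refine isAmpleOn_add isCompact_univ fun x _ => ?_
  obtain ⟨n, hn, s, hs, hsx, V, hV, hVs⟩ := hD.exists_section (x := h x) trivial
  obtain ⟨m, hm, t, ht, htx, W, hW, hWt⟩ := hE.exists_section (x := f x) trivial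
  refine ⟨n, hn, functionFieldMap h s, fun y _ => ?_, m, hm, functionFieldMap f t, fun y _ => ?_,
    h ⁻¹ᵁ V ⊓ f ⁻¹ᵁ W, hf V W hV hW, ⟨(hVs _).mpr ⟨trivial, hsx⟩, (hWt _).mpr ⟨trivial, htx⟩⟩,
    fun y => ?_⟩
  · rw [← map_nsmul]
    exact (hs _ trivial).pullback h
  · rw [← map_nsmul]
    exact (ht _ trivial).pullback f
  · rw [← map_nsmul, ← map_nsmul, (hs (h y) trivial).generatesAt_pullback h,
      (ht (f y) trivial).generatesAt_pullback f]
    refine Iff.trans ?_ (and_iff_right trivial).symm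
    exact and_congr ((hVs _).trans (and_iff_right trivial)) ((hWt _).trans (and_iff_right trivial))

/-- An open subset carrying an ample divisor with a global equation is quasi-affine. -/
lemma IsAmpleOn.isQuasiAffine {X : Scheme.{u}} [IsIntegral X] {D : CartierDivisor X} {U : X.Opens}
    (hD : IsAmpleOn D U) {d : X.functionFieldˣ} (hd : ∀ y ∈ U, IsLocalEquation D y d) :
    U.toScheme.IsQuasiAffine := by
  have : CompactSpace U := isCompact_iff_compactSpace.mp hD.1
  refine .of_forall_exists_mem_basicOpen _ fun x => ?_
  obtain ⟨n, hn, s, hs, hsx, W, hW, hWs⟩ := hD.exists_section x.2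
  have : Nonempty U := ⟨x⟩
  -- Multiplying by the global equation `d ^ n` turns the section into a function on `U` with the
  -- same non-vanishing locus.
  obtain ⟨b, hb⟩ := exists_germToFunctionField_eq U (s * (d ^ n : X.functionFieldˣ)) fun y hy =>
    (hs y hy).exists_eq ((hd y hy).nsmul n)
  have hbW : X.basicOpen b = W := by
    ext y
    refine ⟨fun hy => ?_, fun hy => ?_⟩
    · have hyU := X.basicOpen_le b hy
      exact (hWs y).mpr ⟨hyU, (generatesAt_iff ((hd y hyU).nsmul n)
        ((X.algebraMap_germ_eq_germToFunctionField hyU b).trans hb)).mpr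
          ((X.mem_basicOpen b y hyU).mp hy)⟩
    · have hyU := ((hWs y).mp hy).1
      exact (X.mem_basicOpen b y hyU).mpr ((generatesAt_iff ((hd y hyU).nsmul n)
        ((X.algebraMap_germ_eq_germToFunctionField hyU b).trans hb)).mp ((hWs y).mp hy).2)
  have hbU : U.toScheme.basicOpen (U.topIso.inv b) = U.ι ⁻¹ᵁ W := by
    rw [← hbW, ← U.ι_image_basicOpen_topIso_inv, Scheme.Hom.preimage_image_eq]
  refine ⟨U.topIso.inv b, ?_, ?_⟩
  · rw [hbU]
    exact hW.preimage_of_isOpenImmersion _ (by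
      rw [Scheme.Opens.opensRange_ι]
      exact fun y hy => ((hWs y).mp hy).1)
  · rw [hbU]
    exact (hWs x.1).mpr ⟨x.2, hsx⟩

/-! ## Real coefficients -/

/-- Finitely many positive real numbers are positive under some `ℚ`-linear form `ℝ → ℚ`. -/
lemma exists_linearMap_pos {ι : Type*} [Finite ι] (a : ι → ℝ) (ha : ∀ i, 0 < a i) :
    ∃ φ : ℝ →ₗ[ℚ] ℚ, ∀ i, 0 < φ (a i) := by
  have := Fintype.ofFinite ι
  let V := Submodule.span ℚ (Set.range a)
  have : FiniteDimensional ℚ V := FiniteDimensional.span_of_finite ℚ (Set.finite_range a)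
  let v (i : ι) : V := ⟨a i, Submodule.subset_span ⟨i, rfl⟩⟩
  let b := Module.finBasis ℚ V
  -- `S` consists of the real linear forms, given by their values on `b`, that are positive on all
  -- `a i`. It is open and contains the inclusion `V ⊆ ℝ`, so it contains a rational form by
  -- density.
  let S : Set (Fin (Module.finrank ℚ V) → ℝ) := {q | ∀ i, 0 < ∑ j, (b.repr (v i) j : ℝ) * q j}
  have hS : IsOpen S := by
    simp only [S, Set.ofPred_forall]
    exact isOpen_iInter_of_finite fun i => isOpen_lt continuous_const (by fun_prop)
  have hb : (fun j => (b j : ℝ)) ∈ S := fun i => by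
    have h := congr(V.subtype $(b.sum_repr (v i)))
    rw [map_sum] at h
    simp only [map_smul, Submodule.subtype_apply, Rat.smul_def] at h
    rw [h]
    exact ha i
  obtain ⟨q, hq⟩ := (DenseRange.piMap fun _ : Fin (Module.finrank ℚ V) =>
    Rat.denseRange_cast (𝕜 := ℝ)).exists_mem_open hS ⟨_, hb⟩
  let ψ : V →ₗ[ℚ] ℚ := b.constr ℚ q
  obtain ⟨φ, hφ⟩ := ψ.exists_extend
  refine ⟨φ, fun i => ?_⟩
  have h1 : φ (a i) = ∑ j, b.repr (v i) j * q j := by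
    rw [show φ (a i) = (φ.comp V.subtype) (v i) from rfl, hφ]
    refine (b.constr_apply_fintype ℚ q (v i)).trans ?_
    simp [Module.Basis.equivFun_apply]
  rw [h1]
  have h2 := hq i
  simp only [Pi.map_apply] at h2
  exact_mod_cast h2

/-- A real positive combination which is integral is, up to a multiple, an integral positive
combination. -/
lemma exists_nsmul_eq_sum {C ι : Type*} [AddCommGroup C] [Fintype ι] (c : C) (H : ι → C)
    (a : ι → ℝ) (ha : ∀ i, 0 < a i) (h : (1 : ℝ) ⊗ₜ[ℤ] c = ∑ i, a i ⊗ₜ[ℤ] H i) :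
    ∃ (N : ℕ) (n : ι → ℕ), N ≠ 0 ∧ (∀ i, n i ≠ 0) ∧ N • c = ∑ i, n i • H i := by
  -- The index `none` carries the coefficient `1` of `c`, so that `φ 1` is positive too.
  obtain ⟨φ, hφ⟩ := exists_linearMap_pos (fun i : Option ι => i.elim 1 a)
    (fun i => by cases i with | none => exact one_pos | some i => exact ha i)
  have h1 : (φ 1) ⊗ₜ[ℤ] c = ∑ i, φ (a i) ⊗ₜ[ℤ] H i := by
    have := congr((φ.restrictScalars ℤ).rTensor C $h)
    simpa using this
  let M : ℕ := (φ 1).den * ∏ i, (φ (a i)).den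
  have hM : M ≠ 0 := mul_ne_zero (φ 1).den_ne_zero (Finset.prod_ne_zero_iff.mpr fun i _ =>
    (φ (a i)).den_ne_zero)
  have key (x : ℚ) (hx : 0 < x) (hd : x.den ∣ M) : ∃ n : ℕ, n ≠ 0 ∧ (M : ℚ) * x = n := by
    obtain ⟨k, hk⟩ := hd
    have hk0 : k ≠ 0 := by rintro rfl; exact hM hk
    refine ⟨k * x.num.toNat, mul_ne_zero hk0 ?_, ?_⟩
    · have := Rat.num_pos.mpr hx
      lia
    · have h3 : ((x.num.toNat : ℤ) : ℚ) = x.num := by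
        rw [Int.toNat_of_nonneg (Rat.num_pos.mpr hx).le]
      push_cast at h3
      have h4 := Rat.den_mul_eq_num x
      rw [hk]
      push_cast
      rw [h3, ← h4]
      ring
  obtain ⟨N, hN, hN'⟩ := key (φ 1) (hφ none) (Dvd.intro _ rfl)
  choose n hn hn' using fun i => key (φ (a i)) (hφ (some i))
    ((Finset.dvd_prod_of_mem (fun i => (φ (a i)).den) (Finset.mem_univ i)).trans
      (Dvd.intro_left _ rfl))
  have h2 : (1 : ℚ) ⊗ₜ[ℤ] (N • c - ∑ i, n i • H i) = 0 := by
    have h5 := congr((M : ℚ) • $h1)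
    rw [Finset.smul_sum] at h5
    simp only [TensorProduct.smul_tmul', smul_eq_mul, hN', hn'] at h5
    have h6 (k : ℕ) (x : C) : (k : ℚ) ⊗ₜ[ℤ] x = 1 ⊗ₜ[ℤ] (k • x) := by
      rw [TensorProduct.tmul_smul, TensorProduct.smul_tmul']; simp
    simp only [h6] at h5
    rw [TensorProduct.tmul_sub, h5, TensorProduct.tmul_sum, sub_self]
  -- Vanishing in `ℚ ⊗ C` means being torsion in `C`; the annihilator `k` is absorbed into the
  -- coefficients.
  have := (IsLocalizedModule.eq_zero_iff (nonZeroDivisors ℤ) (TensorProduct.mk ℤ ℚ C 1)).mp h2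
  obtain ⟨⟨k, hk⟩, hk'⟩ := this
  have hk0 : k ≠ 0 := nonZeroDivisors.ne_zero hk
  have hk1 : k.natAbs • (N • c - ∑ i, n i • H i) = 0 := by
    have : k • (N • c - ∑ i, n i • H i) = 0 := hk'
    obtain h | h := Int.natAbs_eq k
    · rw [h] at this; simpa using this
    · rw [h] at this; simpa using this
  refine ⟨k.natAbs * N, fun i => k.natAbs * n i, mul_ne_zero (by simpa) hN,
    fun i => mul_ne_zero (by simpa) (hn i), ?_⟩
  rw [smul_sub, sub_eq_zero, Finset.smul_sum] at hk1
  simpa only [mul_smul] using hk1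

/-! ## Finiteness of the morphism from a core model to the product -/

open Limits

/-- The box is the image of the open immersion from the affine scheme `V ×_S W`. -/
lemma isAffineOpen_pullback {X Y S : Scheme.{u}} [IsAffine S] (f : X ⟶ S) (g : Y ⟶ S)
    {V : X.Opens} (hV : IsAffineOpen V) {W : Y.Opens} (hW : IsAffineOpen W) :
    IsAffineOpen (pullback.fst f g ⁻¹ᵁ V ⊓ pullback.snd f g ⁻¹ᵁ W) := by
  have : IsAffine V.toScheme := hV
  have : IsAffine W.toScheme := hW
  let p : pullback (V.ι ≫ f) (W.ι ≫ g) ⟶ pullback f g :=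
    pullback.map _ _ _ _ V.ι W.ι (𝟙 S) (by simp) (by simp)
  have h := isAffineOpen_opensRange p
  convert h
  ext1
  simp [p, Scheme.Pullback.range_map]

/-- A quasi-affine scheme which is universally closed over an affine scheme is affine. -/
lemma isAffine_of_universallyClosed {X S : Scheme.{u}} [X.IsQuasiAffine] [IsAffine S]
    (f : X ⟶ S) [UniversallyClosed f] : IsAffine X := by
  have : UniversallyClosed (X.toSpecΓ ≫ Spec.map f.appTop) := by
    rw [← Scheme.toSpecΓ_naturality]
    infer_instance
  -- The open immersion `X.toSpecΓ` now has closed image, which is also dense, so it is onto.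
  have : UniversallyClosed X.toSpecΓ := .of_comp_of_isSeparated _ (Spec.map f.appTop)
  have : IsIso X.toSpecΓ :=
    (isIso_iff_isOpenImmersion_and_surjective _).mpr ⟨inferInstance, inferInstance⟩
  exact .of_isIso X.toSpecΓ

lemma isAmpleOn_top_of_isAmpleOver {X S : Scheme.{u}} [IsIntegral X] [IsAffine S] {f : X ⟶ S}
    {D : CartierDivisor X} (h : IsAmpleOver f D) : IsAmpleOn D ⊤ :=
  h ⊤ (isAffineOpen_top S)

namespace Variety

instance (X : Variety) : IsSeparated X.str := X.isSeparated

instance (X : Variety) : LocallyOfFiniteType X.str := X.isQuasiProjective.locallyOfFiniteType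

instance (X : Variety) : QuasiCompact X.str := X.isQuasiProjective.quasiCompact

instance (X : Variety) : X.carrier.IsSeparated :=
  (Scheme.isSeparated_iff _).mpr (by
    rw [← terminal.comp_from X.str]
    infer_instance)

lemma exists_isAmpleOn (X : Variety) : ∃ D : CartierDivisor X.carrier, IsAmpleOn D ⊤ := by
  obtain ⟨D, hD⟩ := X.isQuasiProjective.exists_ample
  exact ⟨D, isAmpleOn_top_of_isAmpleOver hD⟩

end Variety

attribute [instance] Contraction.isProper

/-- The morphism to the product given by two contractions. -/
def Contraction.lift {Y X Z : Variety} (h : Contraction Y X) (f : Contraction Y Z) :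
    Y.carrier ⟶ pullback X.str Z.str :=
  pullback.lift h.hom f.hom (h.w.trans f.w.symm)

lemma Contraction.lift_fst {Y X Z : Variety} (h : Contraction Y X) (f : Contraction Y Z) :
    h.lift f ≫ pullback.fst _ _ = h.hom := pullback.lift_fst ..

lemma Contraction.lift_snd {Y X Z : Variety} (h : Contraction Y X) (f : Contraction Y Z) :
    h.lift f ≫ pullback.snd _ _ = f.hom := pullback.lift_snd ..

/-- Cancellation: composing with the separated second projection gives the proper morphism `f`. -/
instance {Y X Z : Variety} (h : Contraction Y X) (f : Contraction Y Z) : IsProper (h.lift f) := by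
  have : IsProper (h.lift f ≫ pullback.snd _ _) := by
    rw [h.lift_snd]
    infer_instance
  exact .of_comp _ (pullback.snd _ _)

/-- If the pullbacks of ample divisors from `X` are ample over `Z`, then the morphism to the
product `X × Z` is finite. -/
lemma isFinite_lift {Y X Z : Variety} (h : Contraction Y X) (f : Contraction Y Z)
    (hA : ∀ A : RCartierDivisor X.carrier, IsRAmpleOver X.str A →
      IsRAmpleOver f.hom (pullbackRCartier h.hom A)) : IsFinite (h.lift f) := by
  obtain ⟨D, hD⟩ := X.isQuasiProjective.exists_ample
  obtain ⟨m, a, H, ha, hH, hDH⟩ := hA (1 ⊗ₜ D)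
    ⟨0, fun _ => 1, fun _ => D, fun _ => one_pos, fun _ => hD, by simp⟩
  obtain ⟨N, n, hN, hn, hNn⟩ := exists_nsmul_eq_sum (pullbackCartier h.hom D) H a ha hDH
  -- A positive integral combination of relatively ample divisors is relatively ample; separatedness
  -- makes the intersections of affine loci affine.
  have hamp : IsAmpleOver f.hom (N • pullbackCartier h.hom D) := fun W hW => by
    rw [hNn]
    exact Finset.sum_induction_nonempty _ (fun E => IsAmpleOn E (f.hom ⁻¹ᵁ W))
      (fun E E' hE hE' => hE.add (fun V V' hV hV' => hV.inf hV') hE') Finset.univ_nonempty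
      fun i _ => (hH i W hW).nsmul (hn i)
  refine IsFinite.iff_isProper_and_isAffineHom.mpr ⟨inferInstance,
    isAffineHom_of_forall_exists_isAffineOpen _ fun t => ?_⟩
  obtain ⟨U, hU, d, hd⟩ := D.2 (pullback.fst X.str Z.str t)
  obtain ⟨_, ⟨V, hV, rfl⟩, htV, hVU⟩ :=
    X.carrier.isBasis_affineOpens.exists_subset_of_mem_open hU U.isOpen
  obtain ⟨_, ⟨W, hW, rfl⟩, htW, -⟩ :=
    Z.carrier.isBasis_affineOpens.exists_subset_of_mem_open
      (Set.mem_univ (pullback.snd X.str Z.str t)) isOpen_univ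
  have hVW := isAffineOpen_pullback X.str Z.str hV hW
  let A := pullback.fst X.str Z.str ⁻¹ᵁ V ⊓ pullback.snd X.str Z.str ⁻¹ᵁ W
  refine ⟨A, ⟨htV, htW⟩, hVW, ?_⟩
  have hA : h.lift f ⁻¹ᵁ A = h.hom ⁻¹ᵁ V ⊓ f.hom ⁻¹ᵁ W := by
    conv_rhs => rw [← h.lift_fst f, ← h.lift_snd f]
    rfl
  have hcomp : IsCompact (h.lift f ⁻¹ᵁ A : Set Y.carrier) :=
    (h.lift f).isCompact_preimage hVW.isCompact
  -- Over the box `A` the ample divisor has the global equation `d ^ N`, since `D` is principal on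
  -- `V`.
  have hqa := ((hamp W hW).mono (V := h.lift f ⁻¹ᵁ A) (hA ▸ inf_le_right) hcomp).isQuasiAffine
    (d := (Units.map (functionFieldMap h.hom).toMonoidHom d) ^ N) fun y hy =>
      (IsLocalEquation.pullback h.hom (hd _ (hVU (hA ▸ hy : y ∈ h.hom ⁻¹ᵁ V ⊓ f.hom ⁻¹ᵁ W).1))).nsmul
        N
  have : IsAffine A.toScheme := hVW
  exact isAffine_of_universallyClosed (h.lift f ∣_ A)

/-! ## Stein factorization -/

/-- A dominant morphism of integral schemes which is bijective on sections over affine open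
subsets forming a cover is bijective on sections over all open subsets. -/
lemma isIso_app_of_surjective {X Y : Scheme.{u}} [IsIntegral X] [IsIntegral Y] (g : X ⟶ Y)
    [IsDominant g] [QuasiCompact g] [QuasiSeparated g]
    (h : ∀ y : Y, ∃ A : Y.Opens, IsAffineOpen A ∧ y ∈ A ∧ Function.Surjective (g.app A))
    (V : Y.Opens) : IsIso (g.app V) := by
  refine (ConcreteCategory.isIso_iff_bijective _).mpr ?_
  obtain hV | ⟨y₀, hy₀⟩ := (V : Set Y).eq_empty_or_nonempty
  · have h1 : V = ⊥ := TopologicalSpace.Opens.ext hV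
    have h2 : Subsingleton Γ(Y, V) := by rw [h1]; infer_instance
    have h3 : Subsingleton Γ(X, g ⁻¹ᵁ V) := by
      rw [h1]; exact inferInstanceAs (Subsingleton Γ(X, ⊥))
    exact ⟨Function.injective_of_subsingleton _, Function.surjective_to_subsingleton _⟩
  have hne : Nonempty V := ⟨⟨y₀, hy₀⟩⟩
  have hpre (W : Y.Opens) [Nonempty W] : Nonempty (g ⁻¹ᵁ W) :=
    ⟨⟨genericPoint X, show g _ ∈ W from map_genericPoint g ▸ genericPoint_mem W⟩⟩
  have hfg (W : Y.Opens) [Nonempty W] (s : Γ(Y, W)) [Nonempty (g ⁻¹ᵁ W)] :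
      functionFieldMap g (Y.germToFunctionField W s) =
      X.germToFunctionField (g ⁻¹ᵁ W) (g.app W s) :=
    functionFieldMap_germ g W (genericPoint_mem W) s
  have := hpre V
  refine ⟨fun s t hst => Y.germToFunctionField_injective V ((functionFieldMap g).injective ?_),
    fun s => ?_⟩
  · rw [hfg, hfg, hst]
  -- Near `y`, `s` is a quotient `c / a ^ k` with `c` a section over `g ⁻¹ᵁ A`. By hypothesis `c`
  -- comes from `Y`, and `a` is invertible at `y`.
  have key : ∀ y ∈ V, ∃ t : Y.presheaf.stalk y,
      functionFieldMap g (algebraMap _ Y.functionField t) = X.germToFunctionField (g ⁻¹ᵁ V) s := by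
    intro y hy
    obtain ⟨A, hA, hyA, hsurj⟩ := h y
    obtain ⟨a, haV, hya⟩ := hA.exists_basicOpen_le (V := V) ⟨y, hy⟩ hyA
    have hneA : Nonempty A := ⟨⟨y, hyA⟩⟩
    have hnea : Nonempty (Y.basicOpen a) := ⟨⟨y, hya⟩⟩
    have := hpre A
    have hbo : X.basicOpen (g.app A a) = g ⁻¹ᵁ Y.basicOpen a := (g.preimage_basicOpen a).symm
    have hnea' : Nonempty (X.basicOpen (g.app A a)) := hbo ▸ hpre (Y.basicOpen a)
    have hle : X.basicOpen (g.app A a) ≤ g ⁻¹ᵁ V := hbo ▸ g.preimage_mono haV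
    have := isLocalization_basicOpen_of_qcqs (g.isCompact_preimage hA.isCompact)
      (g.isQuasiSeparated_preimage hA.isQuasiSeparated) (g.app A a)
    obtain ⟨⟨c, ⟨_, k, rfl⟩⟩, hck⟩ := IsLocalization.surj (Submonoid.powers (g.app A a))
      (X.presheaf.map (homOfLE hle).op s)
    obtain ⟨c, rfl⟩ := hsurj c
    have hc : X.germToFunctionField (g ⁻¹ᵁ V) s *
        functionFieldMap g (Y.germToFunctionField A a) ^ k =
          functionFieldMap g (Y.germToFunctionField A c) := by
      have h1 := congr(X.germToFunctionField (X.basicOpen (g.app A a)) $hck)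
      rw [map_mul, germToFunctionField_map] at h1
      rw [hfg, hfg, ← map_pow]
      refine Eq.trans ?_ (h1.trans (germToFunctionField_map (homOfLE (X.basicOpen_le _)) _))
      exact congr(_ * $((germToFunctionField_map (homOfLE (X.basicOpen_le _)) _).symm))
    obtain ⟨u, hu⟩ := (Y.mem_basicOpen a y hyA).mp hya
    refine ⟨Y.presheaf.germ A y hyA c * (u⁻¹).1 ^ k, ?_⟩
    have hu1 : functionFieldMap g (algebraMap _ Y.functionField (u⁻¹).1) *
        functionFieldMap g (Y.germToFunctionField A a) = 1 := by
      rw [← Y.algebraMap_germ_eq_germToFunctionField hyA, ← hu, ← map_mul, ← map_mul,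
        Units.inv_mul, map_one, map_one]
    rw [map_mul, map_mul, map_pow, map_pow, Y.algebraMap_germ_eq_germToFunctionField hyA, ← hc,
      mul_assoc, mul_comm (_ ^ k), ← mul_pow, hu1, one_pow, mul_one]
  obtain ⟨t₀, ht₀⟩ := key y₀ hy₀
  -- Since `K(Y)` injects into `K(X)`, the local solutions are one and the same rational function.
  obtain ⟨t, ht⟩ := exists_germToFunctionField_eq V (algebraMap _ Y.functionField t₀)
    fun y hy => by
      obtain ⟨t₁, ht₁⟩ := key y hy
      exact ⟨t₁, (functionFieldMap g).injective (ht₁.trans ht₀.symm)⟩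
  exact ⟨t, X.germToFunctionField_injective (g ⁻¹ᵁ V) (by rw [← hfg, ht, ht₀])⟩

lemma isIntegrallyClosed_section {X : Scheme.{u}} [IsIntegral X]
    (hX : ∀ x : X, IsIntegrallyClosed (X.presheaf.stalk x)) (U : X.Opens) [Nonempty U] :
    IsIntegrallyClosed Γ(X, U) := by
  have := isIntegrallyClosedIn_functionField hX U
  have : FaithfulSMul Γ(X, U) X.functionField :=
    (faithfulSMul_iff_algebraMap_injective _ _).mpr (X.germToFunctionField_injective U)
  exact .of_isIntegrallyClosedIn _ X.functionField

/-- Normality descends along morphisms `g` with `g_* 𝒪 = 𝒪`. -/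
lemma isIntegrallyClosed_stalk_of_isIso_app {X Y : Scheme.{u}} [IsIntegral X] [IsIntegral Y]
    (hX : ∀ x : X, IsIntegrallyClosed (X.presheaf.stalk x)) (g : X ⟶ Y) [IsDominant g]
    (hg : ∀ V : Y.Opens, IsIso (g.app V)) (y : Y) : IsIntegrallyClosed (Y.presheaf.stalk y) := by
  obtain ⟨_, ⟨A, hA, rfl⟩, hyA, -⟩ :=
    Y.isBasis_affineOpens.exists_subset_of_mem_open (Set.mem_univ y) isOpen_univ
  have : Nonempty A := ⟨⟨y, hyA⟩⟩
  have : Nonempty (g ⁻¹ᵁ A) :=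
    ⟨⟨genericPoint X, show g _ ∈ A from map_genericPoint g ▸ genericPoint_mem A⟩⟩
  have := isIntegrallyClosed_section hX (g ⁻¹ᵁ A)
  have := hg A
  have : IsIntegrallyClosed Γ(Y, A) :=
    .of_equiv (asIso (g.app A)).commRingCatIsoToRingEquiv.symm
  let := Y.presheaf.algebra_section_stalk ⟨y, hyA⟩
  have := hA.isLocalization_stalk ⟨y, hyA⟩
  exact isIntegrallyClosed_of_isLocalization _ (hA.primeIdealOf ⟨y, hyA⟩).asIdeal.primeCompl
    (Ideal.primeCompl_le_nonZeroDivisors _)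

lemma isIntegral_app_of_universallyClosed {X Y : Scheme.{u}} (p : X ⟶ Y) [UniversallyClosed p]
    {U : Y.Opens} (hU : IsAffineOpen U) : (p.app U).hom.IsIntegral := by
  have : IsAffine U.toScheme := hU
  have h := isIntegral_appTop_of_universallyClosed (p ∣_ U)
  have e : U.ι ''ᵁ ⊤ = U := by simp
  rw [morphismRestrict_appTop] at h
  have h' := (RingHom.isIntegral_respectsIso.cancel_right_isIso (p.app (U.ι ''ᵁ ⊤))
    (X.presheaf.map (eqToHom (image_morphismRestrict_preimage p U ⊤)).op)).mp h
  rwa [e] at h'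

/-- The sections of a proper morphism of integral schemes over an affine open subset of a scheme of
finite type over a field of characteristic zero form a finite algebra. -/
lemma finite_app_of_isProper {k : Type u} [Field k] [CharZero k] {X T : Scheme.{u}} [IsIntegral X]
    (p : X ⟶ T) [IsProper p] (t : T ⟶ Spec (.of k)) [LocallyOfFiniteType t] {U : T.Opens}
    (hU : IsAffineOpen U) : (p.app U).hom.Finite := by
  obtain hV | ⟨x, hx⟩ := (p ⁻¹ᵁ U : Set X).eq_empty_or_nonempty
  · have h1 : p ⁻¹ᵁ U = ⊥ := TopologicalSpace.Opens.ext hV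
    have : Subsingleton Γ(X, p ⁻¹ᵁ U) := by rw [h1]; infer_instance
    exact RingHom.Finite.of_surjective _ (Function.surjective_to_subsingleton _)
  obtain ⟨_, ⟨A, hA, rfl⟩, hxA, hAU⟩ :=
    X.isBasis_affineOpens.exists_subset_of_mem_open hx (p ⁻¹ᵁ U).isOpen
  have hne : Nonempty A := ⟨⟨x, hxA⟩⟩
  have hne' : Nonempty (p ⁻¹ᵁ U) := ⟨⟨x, hx⟩⟩
  -- The sections over `p ⁻¹ᵁ U` are integral over `Γ(T, U)` and embed in `Γ(X, A)`, which is of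
  -- finite type because `A` is affine.
  have hint := isIntegral_app_of_universallyClosed p hU
  have hftA := p.finiteType_appLE hU hA hAU
  have hftU := t.finiteType_appLE (isAffineOpen_top _) hU le_top
  let φ : k →+* Γ(T, U) := (t.appLE ⊤ U le_top).hom.comp (Scheme.ΓSpecIso (.of k)).inv.hom
  have hφ : φ.FiniteType := hftU.comp (RingHom.FiniteType.of_surjective _
    (ConcreteCategory.bijective_of_isIso (Scheme.ΓSpecIso (.of k)).inv).2)
  let := φ.toAlgebra
  let := (p.app U).hom.toAlgebra
  let := (p.appLE U A hAU).hom.toAlgebra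
  let := (X.presheaf.map (homOfLE hAU).op).hom.toAlgebra
  have : IsScalarTower Γ(T, U) Γ(X, p ⁻¹ᵁ U) Γ(X, A) := .of_algebraMap_eq' rfl
  have : Algebra.FiniteType k Γ(T, U) := hφ
  have : Algebra.FiniteType Γ(T, U) Γ(X, A) := hftA
  have : Algebra.IsIntegral Γ(T, U) Γ(X, p ⁻¹ᵁ U) := ⟨hint⟩
  have : FaithfulSMul Γ(X, p ⁻¹ᵁ U) Γ(X, A) := (faithfulSMul_iff_algebraMap_injective _ _).mpr
    (map_injective_of_isIntegral X (homOfLE hAU))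
  exact finite_of_isIntegral_of_finiteType k (R := Γ(X, A))

/-- The factorization of a proper morphism of integral schemes through the normalization. -/
lemma isIso_toNormalization_app {X T : Scheme.{u}} [IsIntegral X] (p : X ⟶ T) [IsProper p]
    (V : p.normalization.Opens) : IsIso (p.toNormalization.app V) := by
  refine isIso_app_of_surjective _ (fun y => ?_) V
  obtain ⟨_, ⟨U, hU, rfl⟩, hyU, -⟩ := T.isBasis_affineOpens.exists_subset_of_mem_open
    (Set.mem_univ (p.fromNormalization y)) isOpen_univ
  refine ⟨p.fromNormalization ⁻¹ᵁ U, hU.preimage _, hyU, fun x => ?_⟩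
  have hpre : p ⁻¹ᵁ U = p.toNormalization ⁻¹ᵁ p.fromNormalization ⁻¹ᵁ U := by
    rw [← Scheme.Hom.comp_preimage, Scheme.Hom.toNormalization_fromNormalization]
  obtain ⟨-, hrange⟩ := toNormalization_appLE p hU rfl hpre.le
  let r := X.presheaf.map (eqToHom hpre).op
  have hr : Function.Injective r := (ConcreteCategory.bijective_of_isIso r).1
  -- The normalization keeps the integral sections only, but for proper `p` all sections are
  -- integral.
  obtain ⟨y, hy⟩ := (hrange (r x)).mpr (isIntegral_app_of_universallyClosed p hU _)
  exact ⟨y, hr hy⟩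

/-- The finite part of the Stein factorization, over a field of characteristic zero. -/
lemma isFinite_fromNormalization {k : Type u} [Field k] [CharZero k] {X T : Scheme.{u}}
    [IsIntegral X] (p : X ⟶ T) [IsProper p] (t : T ⟶ Spec (.of k)) [LocallyOfFiniteType t] :
    IsFinite p.fromNormalization := by
  refine ⟨fun U hU => ?_⟩
  have h := finite_app_of_isProper p t hU
  have := isIso_toNormalization_app p (p.fromNormalization ⁻¹ᵁ U)
  have hpre : p ⁻¹ᵁ U = p.toNormalization ⁻¹ᵁ p.fromNormalization ⁻¹ᵁ U := by
    rw [← Scheme.Hom.comp_preimage, Scheme.Hom.toNormalization_fromNormalization]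
  have h1 : p.fromNormalization.app U ≫ p.toNormalization.app _ ≫
      X.presheaf.map (eqToHom hpre).op = p.app U := by
    have h2 := p.toNormalization.appLE_comp_appLE p.fromNormalization U _ (p ⁻¹ᵁ U) le_rfl hpre.le
    simp only [Scheme.Hom.toNormalization_fromNormalization] at h2
    simp only [Scheme.Hom.app_eq_appLE, Scheme.Hom.appLE_map, ← h2]
  rw [← h1] at h
  exact (RingHom.finite_respectsIso.cancel_right_isIso (p.fromNormalization.app U)
    (p.toNormalization.app _ ≫ X.presheaf.map (eqToHom hpre).op)).mp h

/-! ## Existence of core models -/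

/-- Ampleness restricts to quasi-compact opens, so an ample divisor on the source settles
quasi-projectivity over every target. -/
lemma isQuasiProjective_of_isAmpleOn_top {X S : Scheme.{u}} [IsIntegral X] (f : X ⟶ S)
    [LocallyOfFiniteType f] [QuasiCompact f] {D : CartierDivisor X} (hD : IsAmpleOn D ⊤) :
    IsQuasiProjective f :=
  ⟨inferInstance, inferInstance, D, fun _ hV =>
    hD.mono le_top (f.isCompact_preimage hV.isCompact)⟩

/-- A morphism through which a contraction factors by a dominant proper morphism with the same
sections is a contraction. -/
def Contraction.ofFactor {Y' Y X : Variety} (h : Contraction Y' X) (g : Y'.carrier ⟶ Y.carrier)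
    [IsDominant g] [UniversallyClosed g] (hg : ∀ V : Y.carrier.Opens, IsIso (g.app V))
    (k : Y.carrier ⟶ X.carrier) (hk : k ≫ X.str = Y.str) (hgk : g ≫ k = h.hom) :
    Contraction Y X where
  hom := k
  w := hk
  isProper := by
    have : IsProper (g ≫ k) := hgk ▸ inferInstance
    have : IsSeparated (k ≫ X.str) := hk ▸ inferInstance
    have : LocallyOfFiniteType (k ≫ X.str) := hk ▸ inferInstance
    have : IsSeparated k := .of_comp k X.str
    have : LocallyOfFiniteType k := locallyOfFiniteType_of_comp k X.str
    have : UniversallyClosed k := .of_comp_surjective g k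
    constructor
  isQuasiProjective := by
    obtain ⟨D, hD⟩ := Y.exists_isAmpleOn
    have : IsProper (g ≫ k) := hgk ▸ inferInstance
    have : LocallyOfFiniteType (k ≫ X.str) := hk ▸ inferInstance
    have : LocallyOfFiniteType k := locallyOfFiniteType_of_comp k X.str
    have : UniversallyClosed k := .of_comp_surjective g k
    exact isQuasiProjective_of_isAmpleOn_top k hD
  isIso_app U := by
    have := h.isIso_app U
    have := hg (k ⁻¹ᵁ U)
    have h1 : IsIso ((g ≫ k).app U) := by
      have h2 (l : Y'.carrier ⟶ X.carrier) (hl : l = h.hom) : IsIso (l.app U) := by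
        subst hl
        infer_instance
      exact h2 _ hgk
    have h3 : IsIso (k.app U ≫ g.app (k ⁻¹ᵁ U)) := Scheme.Hom.comp_app g k U ▸ h1
    exact @IsIso.of_isIso_comp_right _ _ _ _ _ _ _ _ h3

/-- The middle term of the Stein factorization of a proper morphism from a variety to a product of
varieties, which is dominant over both factors. -/
def steinVariety {Y X Z : Variety} (h : Contraction Y X) (f : Contraction Y Z) : Variety where
  carrier := (h.lift f).normalization
  str := (h.lift f).fromNormalization ≫ pullback.fst X.str Z.str ≫ X.str
  isIntegral := inferInstance
  isSeparated := inferInstance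
  isNormal := isIntegrallyClosed_stalk_of_isIso_app Y.isNormal (h.lift f).toNormalization
    (isIso_toNormalization_app _)
  isQuasiProjective := by
    set p := h.lift f
    have := isFinite_fromNormalization p (pullback.fst X.str Z.str ≫ X.str)
    -- Dominance over each factor is what allows Cartier divisors to be pulled back.
    have h1 : IsDominant (p.fromNormalization ≫ pullback.fst X.str Z.str) := by
      have : IsDominant (p.toNormalization ≫ p.fromNormalization ≫ pullback.fst X.str Z.str) := by
        rw [Scheme.Hom.toNormalization_fromNormalization_assoc, h.lift_fst]
        infer_instance
      exact .of_comp p.toNormalization _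
    have h2 : IsDominant (p.fromNormalization ≫ pullback.snd X.str Z.str) := by
      have : IsDominant (p.toNormalization ≫ p.fromNormalization ≫ pullback.snd X.str Z.str) := by
        rw [Scheme.Hom.toNormalization_fromNormalization_assoc, h.lift_snd]
        infer_instance
      exact .of_comp p.toNormalization _
    obtain ⟨D, hD⟩ := X.exists_isAmpleOn
    obtain ⟨E, hE⟩ := Z.exists_isAmpleOn
    have : CompactSpace p.normalization := QuasiCompact.compactSpace_of_compactSpace
      (p.fromNormalization ≫ pullback.fst X.str Z.str ≫ X.str)
    refine isQuasiProjective_of_isAmpleOn_top _ (isAmpleOn_pullbackCartier_add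
      (p.fromNormalization ≫ pullback.fst X.str Z.str)
      (p.fromNormalization ≫ pullback.snd X.str Z.str) (fun V W hV hW => ?_) hD hE)
    exact (isAffineOpen_pullback X.str Z.str hV hW).preimage p.fromNormalization

/-- As `q` is affine, preimages of affine boxes are affine, so the ample summands of an `ℝ`-divisor
on `X` pull back to divisors ample over `Z`. The factor `g` is proper by cancellation against `q`.
-/
lemma exists_isCoreModel_of_factor {X' X Z Y : Variety} (h : Contraction X' X)
    (f : Contraction X' Z) (g : X'.carrier ⟶ Y.carrier) [IsDominant g]
    (hg : ∀ V : Y.carrier.Opens, IsIso (g.app V)) (q : Y.carrier ⟶ pullback X.str Z.str)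
    [IsAffineHom q] (hgq : g ≫ q = h.lift f) (hq : q ≫ pullback.fst X.str Z.str ≫ X.str = Y.str) :
    ∃ (hbar : Contraction Y X) (fbar : Contraction Y Z), IsCoreModel h f hbar fbar := by
  have hp1 : g ≫ q ≫ pullback.fst X.str Z.str = h.hom := by
    rw [← Category.assoc, hgq, h.lift_fst]
  have hp2 : g ≫ q ≫ pullback.snd X.str Z.str = f.hom := by
    rw [← Category.assoc, hgq, h.lift_snd]
  have hprop : IsProper g := by
    have : IsProper (g ≫ q) := hgq ▸ inferInstance
    exact .of_comp _ q
  have hq' : (q ≫ pullback.fst X.str Z.str) ≫ X.str = Y.str := by rwa [Category.assoc]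
  have hq'' : (q ≫ pullback.snd X.str Z.str) ≫ Z.str = Y.str := by
    rwa [Category.assoc, ← pullback.condition]
  let hbar := h.ofFactor g hg (q ≫ pullback.fst X.str Z.str) hq' hp1
  let fbar := f.ofFactor g hg (q ≫ pullback.snd X.str Z.str) hq'' hp2
  refine ⟨hbar, fbar, ?_, ⟨g, ?_, hprop, ?_, hg⟩, hp1, hp2⟩
  · rintro A ⟨m, a, H, ha, hH, rfl⟩
    refine ⟨m, a, fun i => pullbackCartier hbar.hom (H i), ha, fun i => ?_, ?_⟩
    · exact isAmpleOver_pullbackCartier hbar.hom fbar.hom (fun V W hV hW =>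
        (isAffineOpen_pullback X.str Z.str hV hW).preimage q) (isAmpleOn_top_of_isAmpleOver (hH i))
    · simp [pullbackRCartier]
  · rw [← hq', ← Category.assoc, hp1, h.w]
  · obtain ⟨D, hD⟩ := X'.exists_isAmpleOn
    exact isQuasiProjective_of_isAmpleOn_top g hD

lemma exists_isCoreModel {X' X Z : Variety} (h : Contraction X' X) (f : Contraction X' Z) :
    ∃ (Xbar : Variety) (hbar : Contraction Xbar X) (fbar : Contraction Xbar Z),
      IsCoreModel h f hbar fbar :=
  ⟨steinVariety h f, @exists_isCoreModel_of_factor _ _ _ (steinVariety h f) h f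
    (h.lift f).toNormalization (inferInstanceAs (IsDominant (h.lift f).toNormalization))
    (isIso_toNormalization_app _) (h.lift f).fromNormalization
    (inferInstanceAs (IsAffineHom (h.lift f).fromNormalization))
    (h.lift f).toNormalization_fromNormalization rfl⟩

/-! ## Uniqueness of core models -/

/-- A normal scheme which is integral over `T` is determined by a field-valued point of `T`. -/
lemma exists_iso_of_comp_eq {Y₁ Y₂ T : Scheme.{u}} [IsIntegral Y₁] [IsIntegral Y₂]
    (hY₁ : ∀ y : Y₁, IsIntegrallyClosed (Y₁.presheaf.stalk y))
    (hY₂ : ∀ y : Y₂, IsIntegrallyClosed (Y₂.presheaf.stalk y))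
    (q₁ : Y₁ ⟶ T) [IsIntegralHom q₁] (q₂ : Y₂ ⟶ T) [IsIntegralHom q₂]
    {K : CommRingCat.{u}} [IsLocalRing K] (η₁ : Spec K ⟶ Y₁) (η₂ : Spec K ⟶ Y₂)
    (hη₁ : η₁ (IsLocalRing.closedPoint K) = genericPoint Y₁)
    (hη₂ : η₂ (IsLocalRing.closedPoint K) = genericPoint Y₂)
    (hK₁ : AlgClosedAlong (genericPointMap η₁ hη₁))
    (hK₂ : AlgClosedAlong (genericPointMap η₂ hη₂)) (ζ : Spec K ⟶ T) [QuasiCompact ζ]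
    [QuasiSeparated ζ] (h₁ : η₁ ≫ q₁ = ζ) (h₂ : η₂ ≫ q₂ = ζ) :
    ∃ e : Y₁ ≅ Y₂, e.hom ≫ q₂ = q₁ := by
  -- Both schemes are compared with the normalization of `T` in `ζ`, which involves neither of them.
  have key {Y : Scheme.{u}} [IsIntegral Y]
      (hY : ∀ y : Y, IsIntegrallyClosed (Y.presheaf.stalk y)) (q : Y ⟶ T) [IsIntegralHom q]
      (η : Spec K ⟶ Y) (hη : η (IsLocalRing.closedPoint K) = genericPoint Y)
      (hK : AlgClosedAlong (genericPointMap η hη)) (h : η ≫ q = ζ) :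
      ∃ d : ζ.normalization ≅ Y, d.hom ≫ q = ζ.fromNormalization := by
    subst h
    have := isIso_normalizationDesc hY q η hη hK
    exact ⟨asIso ((η ≫ q).normalizationDesc η q rfl), Scheme.Hom.normalizationDesc_comp _ _ _ rfl⟩
  obtain ⟨d₁, hd₁⟩ := key hY₁ q₁ η₁ hη₁ hK₁ h₁
  obtain ⟨d₂, hd₂⟩ := key hY₂ q₂ η₂ hη₂ hK₂ h₂
  exact ⟨d₁.symm ≪≫ d₂, by
    rw [Iso.trans_hom, Iso.symm_hom, Category.assoc, hd₂, ← hd₁, Iso.inv_hom_id_assoc]⟩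

/-- Normal varieties which are finite over `X × Z` are determined by a field-valued point. -/
lemma exists_iso_of_isFinite_lift {X Z Y₁ Y₂ : Variety} (h₁ : Contraction Y₁ X)
    (f₁ : Contraction Y₁ Z) (h₂ : Contraction Y₂ X) (f₂ : Contraction Y₂ Z)
    [IsFinite (h₁.lift f₁)] [IsFinite (h₂.lift f₂)] {K : CommRingCat.{0}} [IsLocalRing K]
    (η₁ : Spec K ⟶ Y₁.carrier) (η₂ : Spec K ⟶ Y₂.carrier)
    (hη₁ : η₁ (IsLocalRing.closedPoint K) = genericPoint Y₁.carrier)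
    (hη₂ : η₂ (IsLocalRing.closedPoint K) = genericPoint Y₂.carrier)
    (hK₁ : AlgClosedAlong (genericPointMap η₁ hη₁))
    (hK₂ : AlgClosedAlong (genericPointMap η₂ hη₂)) (hh : η₁ ≫ h₁.hom = η₂ ≫ h₂.hom)
    (hf : η₁ ≫ f₁.hom = η₂ ≫ f₂.hom) :
    ∃ e : Y₁.carrier ≅ Y₂.carrier, e.hom ≫ Y₂.str = Y₁.str ∧
      e.hom ≫ h₂.hom = h₁.hom ∧ e.hom ≫ f₂.hom = f₁.hom := by
  -- A morphism from an affine scheme to a separated one is quasi-compact and quasi-separated, as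
  -- needed to form its normalization.
  have : (pullback X.str Z.str).IsSeparated := (Scheme.isSeparated_iff _).mpr (by
    rw [← terminal.comp_from (pullback.fst X.str Z.str ≫ X.str)]
    infer_instance)
  have heq : η₂ ≫ h₂.lift f₂ = η₁ ≫ h₁.lift f₁ := by
    apply pullback.hom_ext
    · rw [Category.assoc, Category.assoc, h₁.lift_fst, h₂.lift_fst, hh]
    · rw [Category.assoc, Category.assoc, h₁.lift_snd, h₂.lift_snd, hf]
  obtain ⟨e, he⟩ := exists_iso_of_comp_eq Y₁.isNormal Y₂.isNormal (h₁.lift f₁) (h₂.lift f₂)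
    η₁ η₂ hη₁ hη₂ hK₁ hK₂ (η₁ ≫ h₁.lift f₁) rfl heq
  have hX : e.hom ≫ h₂.hom = h₁.hom := by
    rw [← h₂.lift_fst f₂, ← Category.assoc, he, h₁.lift_fst]
  refine ⟨e, ?_, hX, ?_⟩
  · rw [← h₂.w, ← Category.assoc, hX, h₁.w]
  · rw [← h₂.lift_snd f₂, ← Category.assoc, he, h₁.lift_snd]

/-- The image of a generic point under a contraction is a generic point, with the same field of
algebraic functions. -/
lemma Contraction.genericPointMap_comp {Y X : Variety} (g : Contraction Y X) {K : CommRingCat.{0}}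
    [IsLocalRing K] (η : Spec K ⟶ Y.carrier)
    (hη : η (IsLocalRing.closedPoint K) = genericPoint Y.carrier)
    (hK : AlgClosedAlong (genericPointMap η hη)) :
    ∃ h : (η ≫ g.hom) (IsLocalRing.closedPoint K) = genericPoint X.carrier,
      AlgClosedAlong (genericPointMap (η ≫ g.hom) h) := by
  have h : (η ≫ g.hom) (IsLocalRing.closedPoint K) = genericPoint X.carrier := by
    exact (Scheme.Hom.comp_apply η g.hom _).trans
      ((congrArg g.hom hη).trans (map_genericPoint g.hom))
  refine ⟨h, ?_⟩
  rw [CoreModel.genericPointMap_comp η hη]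
  exact hK.comp (algClosedAlong_functionFieldMap Y.isNormal g.hom g.isIso_app)

lemma algClosedAlong_fromSpecStalk (X : Scheme.{u}) [IsIntegral X] :
    AlgClosedAlong (genericPointMap (X.fromSpecStalk (genericPoint X))
      Scheme.fromSpecStalk_closedPoint) :=
  algClosedAlong_of_surjective _ fun a => ⟨a, genericPointMap_fromSpecStalk _ a⟩

/-- Core models are unique: two of them are isomorphic if they agree on a field-valued point. -/
lemma exists_iso_of_isCoreModel {X Z X₁ X₂ Y₁ Y₂ : Variety}
    {h₁ : Contraction X₁ X} {f₁ : Contraction X₁ Z} {hY₁ : Contraction Y₁ X}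
    {fY₁ : Contraction Y₁ Z} (H₁ : IsCoreModel h₁ f₁ hY₁ fY₁)
    {h₂ : Contraction X₂ X} {f₂ : Contraction X₂ Z} {hY₂ : Contraction Y₂ X}
    {fY₂ : Contraction Y₂ Z} (H₂ : IsCoreModel h₂ f₂ hY₂ fY₂)
    {K : CommRingCat.{0}} [IsLocalRing K] (η₁ : Spec K ⟶ X₁.carrier) (η₂ : Spec K ⟶ X₂.carrier)
    (hη₁ : η₁ (IsLocalRing.closedPoint K) = genericPoint X₁.carrier)
    (hη₂ : η₂ (IsLocalRing.closedPoint K) = genericPoint X₂.carrier)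
    (hK₁ : AlgClosedAlong (genericPointMap η₁ hη₁))
    (hK₂ : AlgClosedAlong (genericPointMap η₂ hη₂)) (hh : η₁ ≫ h₁.hom = η₂ ≫ h₂.hom)
    (hf : η₁ ≫ f₁.hom = η₂ ≫ f₂.hom) :
    ∃ e : Y₁.carrier ≅ Y₂.carrier, e.hom ≫ Y₂.str = Y₁.str ∧
      e.hom ≫ hY₂.hom = hY₁.hom ∧ e.hom ≫ fY₂.hom = fY₁.hom := by
  obtain ⟨g₁, hg₁, hg₁'⟩ := H₁.factor
  obtain ⟨g₂, hg₂, hg₂'⟩ := H₂.factor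
  have := isFinite_lift hY₁ fY₁ H₁.ample
  have := isFinite_lift hY₂ fY₂ H₂.ample
  -- The points are pushed down to the core models, which become normalizations of `X × Z` in one
  -- common point.
  obtain ⟨p₁, q₁⟩ := g₁.genericPointMap_comp η₁ hη₁ hK₁
  obtain ⟨p₂, q₂⟩ := g₂.genericPointMap_comp η₂ hη₂ hK₂
  refine exists_iso_of_isFinite_lift hY₁ fY₁ hY₂ fY₂ _ _ p₁ p₂ q₁ q₂ ?_ ?_
  · rw [Category.assoc, Category.assoc, hg₁, hg₂, hh]
  · rw [Category.assoc, Category.assoc, hg₁', hg₂', hf]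

/-- The composition of a contraction with an isomorphism. -/
def Contraction.compIso {Y X₁ X₂ : Variety} (g : Contraction Y X₁) (e : X₁.carrier ≅ X₂.carrier)
    (he : e.hom ≫ X₂.str = X₁.str) : Contraction Y X₂ where
  hom := g.hom ≫ e.hom
  w := by rw [Category.assoc, he, g.w]
  isProper := inferInstance
  isQuasiProjective := by
    obtain ⟨D, hD⟩ := Y.exists_isAmpleOn
    exact isQuasiProjective_of_isAmpleOn_top (g.hom ≫ e.hom) hD
  isIso_app U := by
    have := g.isIso_app (e.hom ⁻¹ᵁ U)
    have h : IsIso (e.hom.app U ≫ g.hom.app (e.hom ⁻¹ᵁ U)) := IsIso.comp_isIso' inferInstance this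
    exact Scheme.Hom.comp_app g.hom e.hom U ▸ h

/-- Only the factorization is transported along `e`. Ampleness on `Y₂` is assumed, being already
known in the application. -/
lemma IsCoreModel.of_iso {X' X Z Y₁ Y₂ : Variety} {h : Contraction X' X} {f : Contraction X' Z}
    {h₁ : Contraction Y₁ X} {f₁ : Contraction Y₁ Z} (H : IsCoreModel h f h₁ f₁)
    {h₂ : Contraction Y₂ X} {f₂ : Contraction Y₂ Z}
    (hA : ∀ A : RCartierDivisor X.carrier, IsRAmpleOver X.str A →
      IsRAmpleOver f₂.hom (pullbackRCartier h₂.hom A)) (e : Y₁.carrier ≅ Y₂.carrier)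
    (he : e.hom ≫ Y₂.str = Y₁.str) (hh : e.hom ≫ h₂.hom = h₁.hom)
    (hf : e.hom ≫ f₂.hom = f₁.hom) : IsCoreModel h f h₂ f₂ := by
  obtain ⟨g, hg, hg'⟩ := H.factor
  refine ⟨hA, g.compIso e he, ?_, ?_⟩
  · rw [Contraction.compIso, Category.assoc, hh, hg]
  · rw [Contraction.compIso, Category.assoc, hf, hg']

/-! ## Rational maps -/

lemma fromFunctionField_compHom {X Y Z : Scheme.{u}} [IsIntegral X] (φ : X ⤏ Y) (g : Y ⟶ Z) :
    (φ.compHom g).fromFunctionField = φ.fromFunctionField ≫ g := by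
  obtain ⟨ψ, rfl⟩ := φ.exists_rep
  exact ψ.fromSpecStalkOfMem_compHom g _ _

lemma fromFunctionField_toRationalMap {X Y : Scheme.{u}} [IsIntegral X] (f : X ⟶ Y) :
    f.toRationalMap.fromFunctionField = X.fromSpecStalk (genericPoint X) ≫ f :=
  Scheme.PartialMap.fromSpecStalkOfMem_toPartialMap f _

lemma functionFieldMap_surjective_of_isOpenImmersion {X Y : Scheme.{u}} [IsIntegral X]
    [IsIntegral Y] (j : X ⟶ Y) [IsOpenImmersion j] [IsDominant j] :
    Function.Surjective (functionFieldMap j) := by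
  have : IsIso (Y.presheaf.stalkSpecializes (specializes_of_eq (map_genericPoint j))) :=
    inferInstanceAs (IsIso (Y.presheaf.stalkCongr (.of_eq (map_genericPoint j))).inv)
  exact (ConcreteCategory.bijective_of_isIso (Y.presheaf.stalkSpecializes (specializes_of_eq
    (map_genericPoint j)) ≫ j.stalkMap (genericPoint X))).2

/-- Birational maps induce isomorphisms of function fields. -/
lemma isDominant_and_algClosed_of_partialIso {X Y : Scheme.{u}} [IsIntegral X] [IsIntegral Y]
    (φ : X.PartialIso Y) :
    ∃ _ : φ.toRationalMap.IsDominant, FunctionFieldAlgClosed φ.toRationalMap := by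
  have : IsDominant φ.source.ι := Opens.isDominant_ι φ.dense_source
  have : IsDominant φ.target.ι := Opens.isDominant_ι φ.dense_target
  have : Nonempty φ.source := φ.dense_source.nonempty.to_subtype
  have hdom : φ.toRationalMap.IsDominant :=
    φ.toPartialMap.isDominant_toRationalMap_iff.mpr
      (inferInstanceAs (IsDominant (φ.iso.hom ≫ φ.target.ι)))
  refine ⟨hdom, algClosedAlong_of_surjective _ ?_⟩
  have hx : genericPoint X ∈ φ.source := genericPoint_mem _
  -- `ζ` lifts the generic point of `X` to the source of `φ`. Thus `K(Y) → K(X)` factors through the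
  -- function field of the source, and both factors are onto because they come from open immersions.
  let ζ := φ.source.fromSpecStalkOfMem (genericPoint X) hx
  have hζ : ζ ≫ φ.source.ι = X.fromSpecStalk (genericPoint X) :=
    φ.source.fromSpecStalkOfMem_ι _ _
  have h1 : ζ (IsLocalRing.closedPoint X.functionField) = genericPoint φ.source := by
    apply φ.source.ι.isOpenEmbedding.injective
    rw [map_genericPoint]
    refine (Scheme.Hom.comp_apply ζ φ.source.ι _).symm.trans ?_
    rw [hζ]
    exact Scheme.fromSpecStalk_closedPoint
  have hsurj : Function.Surjective (genericPointMap ζ h1) := by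
    intro a
    have h2 : (ζ ≫ φ.source.ι) (IsLocalRing.closedPoint X.functionField) = genericPoint X := by
      rw [hζ]
      exact Scheme.fromSpecStalk_closedPoint
    have h3 : genericPointMap (ζ ≫ φ.source.ι) h2 a = a := by
      generalize ζ ≫ φ.source.ι = θ at hζ h2
      subst hζ
      exact genericPointMap_fromSpecStalk _ a
    exact ⟨_, congr($(genericPointMap_comp ζ h1 φ.source.ι h2) a).symm.trans h3⟩
  have h4 := genericPointMap_comp ζ h1 (φ.iso.hom ≫ φ.target.ι)
    (fromFunctionField_closedPoint φ.toRationalMap)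
  change Function.Surjective (genericPointMap (ζ ≫ φ.iso.hom ≫ φ.target.ι)
    (fromFunctionField_closedPoint φ.toRationalMap))
  rw [h4]
  exact hsurj.comp (functionFieldMap_surjective_of_isOpenImmersion _)

lemma isDominant_and_algClosed_of_contraction {X Y : Variety} (q : Contraction X Y) :
    ∃ _ : q.hom.toRationalMap.IsDominant, FunctionFieldAlgClosed q.hom.toRationalMap := by
  refine ⟨inferInstance, ?_⟩
  have h : rationalFunctionFieldMap q.hom.toRationalMap = functionFieldMap q.hom :=
    RingHom.ext (rationalFunctionFieldMap_toRationalMap q.hom)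
  change AlgClosedAlong (rationalFunctionFieldMap q.hom.toRationalMap)
  rw [h]
  exact algClosedAlong_functionFieldMap X.isNormal q.hom q.isIso_app

/-- Core models are invariant under dominant rational maps with algebraically closed function
field. -/
lemma IsCoreModel.of_rationalMap {X' X Z Y X'' : Variety} {h : Contraction X' X}
    {f : Contraction X' Z} {hbar : Contraction Y X} {fbar : Contraction Y Z}
    (H : IsCoreModel h f hbar fbar) (φ : X'.carrier ⤏ X''.carrier) [φ.IsDominant]
    (hφ : FunctionFieldAlgClosed φ) {h'' : Contraction X'' X} {f'' : Contraction X'' Z}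
    (hh : φ.compHom h''.hom = h.hom.toRationalMap) (hf : φ.compHom f''.hom = f.hom.toRationalMap) :
    IsCoreModel h'' f'' hbar fbar := by
  -- No morphism from `X''` to `Y` is at hand, so a core model of the new pair is built first and
  -- then identified with `Y` through `Spec K(X')`.
  obtain ⟨Y', hY', fY', H'⟩ := exists_isCoreModel h'' f''
  obtain ⟨e, he, heh, hef⟩ := exists_iso_of_isCoreModel H' H φ.fromFunctionField
    (X'.carrier.fromSpecStalk (genericPoint X'.carrier)) (fromFunctionField_closedPoint φ)
    Scheme.fromSpecStalk_closedPoint hφ (algClosedAlong_fromSpecStalk _)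
    (by rw [← fromFunctionField_compHom, hh, fromFunctionField_toRationalMap])
    (by rw [← fromFunctionField_compHom, hf, fromFunctionField_toRationalMap])
  exact H'.of_iso H.ample e he heh hef

end CoreModel

end

theorem mainTheorem12 {X' X Z : CoreModel.Variety}
    (h : CoreModel.Contraction X' X) (f : CoreModel.Contraction X' Z) :
    -- existence of the core model
    (∃ (Xbar : CoreModel.Variety) (hbar : CoreModel.Contraction Xbar X)
      (fbar : CoreModel.Contraction Xbar Z), CoreModel.IsCoreModel h f hbar fbar) ∧
    -- uniqueness up to isomorphisms compatible with the contractions to `X` and `Z`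
    (∀ (X₁ X₂ : CoreModel.Variety)
      (h₁ : CoreModel.Contraction X₁ X) (f₁ : CoreModel.Contraction X₁ Z)
      (h₂ : CoreModel.Contraction X₂ X) (f₂ : CoreModel.Contraction X₂ Z),
      CoreModel.IsCoreModel h f h₁ f₁ → CoreModel.IsCoreModel h f h₂ f₂ →
      ∃ e : X₁.carrier ≅ X₂.carrier, e.hom ≫ X₂.str = X₁.str ∧
        e.hom ≫ h₂.hom = h₁.hom ∧ e.hom ≫ f₂.hom = f₁.hom) ∧
    -- invariance under replacing `X'` along a dominant rational map `φ`
    (∀ (Xbar : CoreModel.Variety) (hbar : CoreModel.Contraction Xbar X)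
      (fbar : CoreModel.Contraction Xbar Z), CoreModel.IsCoreModel h f hbar fbar →
      ∀ (X'' : CoreModel.Variety) (φ : X'.carrier.RationalMap X''.carrier) [φ.IsDominant],
      CoreModel.FunctionFieldAlgClosed φ →
      ∀ (h'' : CoreModel.Contraction X'' X) (f'' : CoreModel.Contraction X'' Z),
      φ.compHom h''.hom = h.hom.toRationalMap → φ.compHom f''.hom = f.hom.toRationalMap →
      CoreModel.IsCoreModel h'' f'' hbar fbar) ∧
    -- birational maps and contractions are examples of such `φ`
    (∀ (X'' : CoreModel.Variety) (φ : X'.carrier.PartialIso X''.carrier),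
      ∃ _ : φ.toRationalMap.IsDominant, CoreModel.FunctionFieldAlgClosed φ.toRationalMap) ∧
    (∀ (X'' : CoreModel.Variety) (q : CoreModel.Contraction X' X''),
      ∃ _ : q.hom.toRationalMap.IsDominant,
        CoreModel.FunctionFieldAlgClosed q.hom.toRationalMap) := by
  refine ⟨CoreModel.exists_isCoreModel h f, fun X₁ X₂ h₁ f₁ h₂ f₂ H₁ H₂ => ?_,
    fun Xbar hbar fbar H X'' φ _ hφ h'' f'' hh hf => H.of_rationalMap φ hφ hh hf,
    fun X'' φ => CoreModel.isDominant_and_algClosed_of_partialIso φ,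
    fun X'' q => CoreModel.isDominant_and_algClosed_of_contraction q⟩
  exact CoreModel.exists_iso_of_isCoreModel H₁ H₂ _ _ Scheme.fromSpecStalk_closedPoint
    Scheme.fromSpecStalk_closedPoint (CoreModel.algClosedAlong_fromSpecStalk _)
    (CoreModel.algClosedAlong_fromSpecStalk _) rfl rfl
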